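/- A *flip-pushdown automaton* is a one-way nondeterministic pushdown automaton $M=(Q,\Sigma,\Gamma,\delta,\Delta,q_0,Z_0,F)$ with finite $Q,\Sigma,\Gamma$, a finite relation $\delta\subseteq (Q\times(\Sigma\cup\{\lambda\})\times\Gamma)\times(Q\times\Gamma^*)$ and $\Delta\subseteq Q\times Q$, $q_0\in Q$, $Z_0\in\Gamma$, $F\subseteq Q$. Its configurations are triples $(q,w,\gamma)$ of a state, the remaining input and the pushdown content (with the top at the right), and its moves are $(q,aw,\gamma Z)\vdash(p,w,\gamma\beta)$ for $(q,a,Z,p,\beta)\in\delta$ with $a \in \Sigma\cup\{\lambda\}$ ($\beta$ being written with its top at the right), and the flips $(q,w,Z_0\gamma)\vdash(p,w,Z_0\gamma^R)$ for $(q,p)\in\Delta$, where $\gamma^R$ is the reversal of $\gamma$. As a *$k$-flip pushdown automaton*, $M$ accepts the language $L_k(M)$ of all $w\in\Sigma^*$ that have an accepting computation $(q_0,w,Z_0)\vdash^*(q,\lambda,\gamma)$, $q\in F$, with at most $k$ flips. It is *reversal-bounded* if there is an $l$ such that every accepting computation with at most $k$ flips switches at most $l$ times between increasing and decreasing the size of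 the pushdown. A language $L\subseteq\Sigma^*$ is *dense* if every word of $\Sigma^*$ is an infix of some word of $L$. **Theorem.** It is decidable, given a reversal-bounded $k$-flip pushdown automaton, whether the language it accepts is dense. That is, there is an algorithm which, for every $k\ge 0$ and every flip-pushdown automaton $M$ that is reversal-bounded as a $k$-flip pushdown automaton, halts on the input consisting of $k$ and a description of $M$ and answers correctly whether $L_k(M)$ is dense. (Nothing is required of the algorithm on other inputs.) -/

import Mathlib

/-- The set of infixes (subwords) of words of a language: `y` such that `x ++ y ++ z ∈ L`. -/
def Language.infixes {σ : Type} (L : Language σ) : Language σ :=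
  {y | ∃ w ∈ L, y <:+: w}

/-- A language over the alphabet `σ` is dense if every word over `σ` is an infix of it. -/
def Language.IsDense {σ : Type} (L : Language σ) : Prop :=
  L.infixes = (Set.univ : Set (List σ))

/-- A one-way nondeterministic flip-pushdown automaton with states `Q`, input alphabet `σ` and
pushdown alphabet `Γ` (all of them meant to be finite). The finite transition relations are given
by lists, whose order and repetitions play no role. -/
structure FlipPDA (Q σ Γ : Type) where
  /-- `(q, a, Z, p, β)` : in state `q`, reading `a` (`none` for the empty word) and with `Z` on top
  of the pushdown, go to state `p` and replace `Z` by the word `β`. -/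
  trans : List (Q × Option σ × Γ × Q × List Γ)
  /-- `(q, p)` : in state `q`, flip the pushdown and go to state `p`. -/
  flips : List (Q × Q)
  /-- initial state -/
  start : Q
  /-- bottom-of-pushdown symbol, the initial content of the pushdown -/
  bottom : Γ
  /-- final states -/
  final : List Q

namespace FlipPDA

/-- A configuration: state, remaining input, content of the pushdown (its top is the head of the
list). -/
structure Config (Q σ Γ : Type) where
  state : Q
  input : List σ
  stack : List Γ

variable {Q σ Γ : Type}

/-- An ordinary pushdown move. -/
inductive Move (M : FlipPDA Q σ Γ) : Config Q σ Γ → Config Q σ Γ → Prop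
  | mk (q p : Q) (a : Option σ) (w : List σ) (Z : Γ) (β s : List Γ)
      (h : (q, a, Z, p, β) ∈ M.trans) :
      Move M ⟨q, a.toList ++ w, Z :: s⟩ ⟨p, w, β ++ s⟩

/-- A flip: everything above the bottom-of-pushdown symbol is reversed, no input is read. -/
inductive Flip (M : FlipPDA Q σ Γ) : Config Q σ Γ → Config Q σ Γ → Prop
  | mk (q p : Q) (w : List σ) (s : List Γ) (h : (q, p) ∈ M.flips) :
      Flip M ⟨q, w, s ++ [M.bottom]⟩ ⟨p, w, s.reverse ++ [M.bottom]⟩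

/-- `M.Run c i hs d`: there is a computation of `M` from `c` to `d` that flips the pushdown exactly
`i` times and along which the successive sizes of the pushdown are `hs` (both ends included). -/
inductive Run (M : FlipPDA Q σ Γ) : Config Q σ Γ → ℕ → List ℕ → Config Q σ Γ → Prop
  | refl (c : Config Q σ Γ) : Run M c 0 [c.stack.length] c
  | move {c d e : Config Q σ Γ} {i : ℕ} {hs : List ℕ} :
      M.Move c d → Run M d i hs e → Run M c i (c.stack.length :: hs) e
  | flip {c d e : Config Q σ Γ} {i : ℕ} {hs : List ℕ} :
      M.Flip c d → Run M d i hs e → Run M c (i + 1) (c.stack.length :: hs) e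

/-- `M.AcceptingRun w i hs`: there is a computation of `M` on the input `w` that starts in the
initial configuration, reads all of `w` and ends in a final state, with exactly `i` flips and
successive pushdown sizes `hs`. -/
def AcceptingRun (M : FlipPDA Q σ Γ) (w : List σ) (i : ℕ) (hs : List ℕ) : Prop :=
  ∃ q ∈ M.final, ∃ s : List Γ, M.Run ⟨M.start, w, [M.bottom]⟩ i hs ⟨q, [], s⟩

/-- The language accepted by `M` as a `k`-flip pushdown automaton: acceptance by final state with
at most `k` flips. -/
def language (M : FlipPDA Q σ Γ) (k : ℕ) : Language σ :=
  {w | ∃ i ≤ k, ∃ hs, M.AcceptingRun w i hs}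

/-- The directions of the strict changes in a sequence of sizes (`true`: increase, `false`:
decrease); steps that keep the size are skipped. -/
def directions : List ℕ → List Bool
  | a :: b :: l =>
      if a < b then true :: directions (b :: l)
      else if b < a then false :: directions (b :: l)
      else directions (b :: l)
  | _ => []

/-- The number of positions at which two consecutive entries differ. -/
def changes : List Bool → ℕ
  | a :: b :: l => (if a = b then 0 else 1) + changes (b :: l)
  | _ => 0

/-- The number of switches between increasing and decreasing in a sequence of sizes. -/
def reversals (hs : List ℕ) : ℕ := changes (directions hs)

/-- `M` is reversal-bounded as a `k`-flip pushdown automaton: some bound `l` holds for the number of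
switches between increasing and decreasing the size of the pushdown in all accepting computations
(with at most `k` flips). -/
def ReversalBounded (M : FlipPDA Q σ Γ) (k : ℕ) : Prop :=
  ∃ l : ℕ, ∀ (w : List σ) (i : ℕ) (hs : List ℕ),
    i ≤ k → M.AcceptingRun w i hs → reversals hs ≤ l

/-- Finite descriptions of machines: the numbers of states, of input letters and of pushdown
symbols; the transitions; the flip transitions; initial state; bottom symbol; final states. -/
abbrev Code : Type :=
  (ℕ × ℕ × ℕ) × List (ℕ × Option ℕ × ℕ × ℕ × List ℕ) × List (ℕ × ℕ) × ℕ × ℕ × List ℕ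

/-- The description of a machine whose states and symbols are numbered. -/
def code {m n g : ℕ} (M : FlipPDA (Fin m) (Fin n) (Fin g)) : Code :=
  ((m, n, g),
   M.trans.map fun t =>
     (t.1.val, t.2.1.map Fin.val, t.2.2.1.val, t.2.2.2.1.val, t.2.2.2.2.map Fin.val),
   M.flips.map fun t => (t.1.val, t.2.val),
   M.start.val, M.bottom.val, M.final.map Fin.val)

end FlipPDA

/-! Cut an accepting computation at its flips and at its switches between growing and shrinking.
Reversal-boundedness bounds the number of pieces, and within each piece the size of the pushdown is
monotone. If some `y₁` is never read inside a nondecreasing piece and some `y₂` never inside a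
nonincreasing one, then a high power of `y₁ ++ y₂` is not an infix of an accepted word, since one of
its factors would lie within a single piece. Hence the language is dense iff all words are read
inside nondecreasing pieces or all words inside nonincreasing ones (`isDense_iff`).

From any moment of a nondecreasing piece on, the piece can use only the current top symbol; what
lies below matters only for whether the computation can be completed afterwards. The pushdown words
that lead to acceptance with a given number of flips form regular sets of computably bounded index
(`finIndex_reach`), because reversal preserves regularity. So the words read in nondecreasing pieces
have boundedly many left quotients (`phase_index`), and all words occur as soon as all words up to a
computable length do. Nonincreasing pieces are nondecreasing pieces read backwards. Being read in
such a piece is semidecidable, hence so is density.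

Non-density is semidecidable as well. If `x` is no infix of an accepted word, the reachable pushdown
words of the product of the machine with an automaton matching `x` have finite index. Finitely many
classes, compatible with pushing and reversal, then yield an inductive invariant that excludes
acceptance after a match (`exists_nondenseCheck`), and any valid invariant refutes density
(`not_isDense_of_nondenseCheck`). The algorithm runs both searches in parallel. -/

namespace FlipPDA

/-! ### Prefix rewriting with flips -/

/-- A prefix rewriting system with states and labels whose words may moreover be flipped. -/
structure RewriteSystem (Q σ Γ : Type) where
  /-- `rule q a α p β` : in state `q`, reading `a`, replace the prefix `α` by `β` and go to `p`. -/
  rule : Q → Option σ → List Γ → Q → List Γ → Prop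
  /-- state changes that go with a flip -/
  flip : Q → Q → Prop
  /-- the last symbol of a word that can be flipped -/
  bottom : Γ

namespace RewriteSystem

variable {Q σ Γ : Type} {S : RewriteSystem Q σ Γ}

/-- The system with all rules and flips read backwards. -/
def rev (S : RewriteSystem Q σ Γ) : RewriteSystem Q σ Γ :=
  ⟨fun p a β q α => S.rule q a α p β, fun p q => S.flip q p, S.bottom⟩

/-- Reachability from a configuration in `I` with a given number of flips. -/
inductive Reach (S : RewriteSystem Q σ Γ) (I : Q → List Γ → Prop) : ℕ → Q → List Γ → Prop
  | init {q : Q} {s : List Γ} : I q s → Reach S I 0 q s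
  | step {i : ℕ} {q p : Q} {a : Option σ} {α β t : List Γ} :
      Reach S I i q (α ++ t) → S.rule q a α p β → Reach S I i p (β ++ t)
  | flip {i : ℕ} {q p : Q} {t : List Γ} :
      Reach S I i q (t ++ [S.bottom]) → S.flip q p → Reach S I (i + 1) p (t.reverse ++ [S.bottom])

/-- Flip-free computations that use only rules `α → β` with `ok α β`, and the words they read. -/
inductive Path (S : RewriteSystem Q σ Γ) (ok : List Γ → List Γ → Prop) (q : Q) (s : List Γ) :
    List σ → Q → List Γ → Prop
  | refl : Path S ok q s [] q s
  | snoc {p p' : Q} {α β t : List Γ} {w : List σ} {a : Option σ} :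
      Path S ok q s w p (α ++ t) → S.rule p a α p' β → ok α β →
      Path S ok q s (w ++ a.toList) p' (β ++ t)

variable {ok : List Γ → List Γ → Prop} {q p p' : Q} {s t t' : List Γ} {w w' : List σ}

theorem Path.trans (h : S.Path ok q s w p t) (h' : S.Path ok p t w' p' t') :
    S.Path ok q s (w ++ w') p' t' := by
  induction h' with
  | refl => simpa using h
  | snoc _ hr hk ih => rw [← List.append_assoc]; exact .snoc ih hr hk

theorem Path.single {a : Option σ} {α β : List Γ} (hr : S.rule q a α p β) (hk : ok α β)
    (t : List Γ) : S.Path ok q (α ++ t) a.toList p (β ++ t) := by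
  simpa using Path.snoc (.refl) hr hk

theorem Path.rev (h : S.Path ok q s w p t) :
    S.rev.Path (fun β α => ok α β) p t w.reverse q s := by
  induction h with
  | refl => exact .refl
  | @snoc p p' α β t w a _ hr hk ih =>
    have := (Path.single (S := S.rev) (ok := fun β α => ok α β) (q := p') (p := p) hr hk t).trans ih
    cases a <;> simpa using this

theorem Path.append_stack (h : S.Path ok q s w p t) (y : List Γ) :
    S.Path ok q (s ++ y) w p (t ++ y) := by
  induction h with
  | refl => exact .refl
  | snoc _ hr hk ih =>
    rw [List.append_assoc] at ih ⊢
    exact .snoc ih hr hk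

theorem Path.split (h : S.Path ok q s w p t) (u v : List σ) (e : w = u ++ v) :
    ∃ m r, S.Path ok q s u m r ∧ S.Path ok m r v p t := by
  induction h generalizing u v with
  | refl =>
    obtain ⟨rfl, rfl⟩ := List.append_eq_nil_iff.1 e.symm
    exact ⟨q, s, .refl, .refl⟩
  | @snoc p p' α β t w a h hr hk ih =>
    rcases List.eq_nil_or_concat' v with rfl | ⟨v', c, rfl⟩
    · refine ⟨p', _, ?_, .refl⟩
      rw [List.append_nil] at e
      exact e ▸ .snoc h hr hk
    · cases a with
      | none =>
        obtain ⟨m, r, h₁, h₂⟩ := ih u (v' ++ [c]) (by simpa using e)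
        exact ⟨m, r, h₁, by simpa using h₂.snoc hr hk⟩
      | some a =>
        rw [← List.append_assoc] at e
        obtain ⟨e, e'⟩ := List.append_inj' e rfl
        obtain ⟨m, r, h₁, h₂⟩ := ih u v' e
        exact ⟨m, r, h₁, by simpa [← e'] using h₂.snoc hr hk⟩

theorem Reach.path {I : Q → List Γ → Prop} {i : ℕ} (h : S.Reach I i q s)
    (h' : S.Path ok q s w p t) : S.Reach I i p t := by
  induction h' with
  | refl => exact h
  | snoc _ hr _ ih => exact .step ih hr

/-- In a computation that never shortens the word and whose rules replace at most one symbol, all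
but the first symbol of the initial word is left untouched. -/
theorem Path.exists_untouched (hS : ∀ q a α p β, S.rule q a α p β → ok α β →
      α.length ≤ β.length ∧ α.length ≤ 1) (h : S.Path ok q s w p t) :
    ∃ (Z : Option Γ) (y ζ : List Γ), s = Z.toList ++ y ∧ t = ζ ++ y ∧
      S.Path ok q Z.toList w p ζ := by
  rcases s with - | ⟨Z, y⟩
  · exact ⟨none, [], t, rfl, by simp, h⟩
  -- Nonemptiness of `ζ` keeps a rule with a one-symbol left side from reaching into `y`.
  · suffices ∃ ζ, ζ ≠ [] ∧ t = ζ ++ y ∧ S.Path ok q [Z] w p ζ by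
      obtain ⟨ζ, -, h₁, h₂⟩ := this
      exact ⟨some Z, y, ζ, rfl, h₁, h₂⟩
    generalize hs : Z :: y = s at h
    induction h with
    | refl => exact ⟨[Z], by simp, by simp [← hs], .refl⟩
    | @snoc p p' α β t w a h hr hk ih =>
      obtain ⟨ζ, hζ, e, hp⟩ := ih
      obtain ⟨h₁, h₂⟩ := hS _ _ _ _ _ hr hk
      obtain ⟨Y, ζ, rfl⟩ := List.exists_cons_of_ne_nil hζ
      match α, h₂ with
      | [], _ =>
        simp only [List.nil_append] at e
        refine ⟨β ++ Y :: ζ, by simp, by simp [e], ?_⟩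
        exact Path.snoc (α := []) (by simpa using hp) hr hk
      | [X], _ =>
        simp only [List.cons_append, List.nil_append, List.cons.injEq] at e
        obtain ⟨rfl, rfl⟩ := e
        refine ⟨β ++ ζ, ?_, by simp, Path.snoc (α := [X]) (by simpa using hp) hr hk⟩
        rintro h
        simp_all

/-- The configurations in which a computation can be after `i` flips and no further move. -/
def Start (S : RewriteSystem Q σ Γ) (I : Q → List Γ → Prop) : ℕ → Q → List Γ → Prop
  | 0, q, s => I q s
  | i + 1, q, s => ∃ p t, S.flip p q ∧ S.Reach I i p (t ++ [S.bottom]) ∧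
      s = t.reverse ++ [S.bottom]

theorem Start.reach {I : Q → List Γ → Prop} {i : ℕ} (h : S.Start I i q s) : S.Reach I i q s := by
  cases i with
  | zero => exact .init h
  | succ i =>
    obtain ⟨p, t, hf, h, rfl⟩ := h
    exact .flip h hf

/-- A reachable configuration comes from one of boundedly many in which the suffix `u` is
uncovered but for a short word, or from a start with suffix `u`, without touching `u` again. -/
theorem reach_append_iff {I : Q → List Γ → Prop} {m : ℕ}
    (hm : ∀ q a α p β, S.rule q a α p β → β.length ≤ m) (i : ℕ) (q : Q) (v u : List Γ) :
    S.Reach I i q (v ++ u) ↔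
      (∃ p t, S.Start I i p (t ++ u) ∧ ∃ w, S.Path (fun _ _ => True) p t w q v) ∨
      (∃ p β, β.length ≤ m ∧ S.Reach I i p (β ++ u) ∧
        ∃ w, S.Path (fun _ _ => True) p β w q v) := by
  constructor
  · intro h
    generalize hs : v ++ u = s at h
    induction h generalizing v with
    | @init q s h => exact .inl ⟨q, v, by simpa [Start, hs] using h, [], .refl⟩
    | @flip i q p t h hf ih => exact .inl ⟨p, v, ⟨q, t, hf, h, hs⟩, [], .refl⟩
    | @step i q p a α β t h hr ih =>
      -- If `β` reaches down to `u`, then `v` is a prefix of `β`, hence short; otherwise `u` lies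
      -- below the rewritten part and the induction hypothesis applies.
      rcases List.append_eq_append_iff.1 hs with ⟨y, rfl, rfl⟩ | ⟨y, rfl, rfl⟩
      · refine .inr ⟨p, v, ?_, ?_, [], .refl⟩
        · have := hm _ _ _ _ _ hr
          simp only [List.length_append] at this
          omega
        · simpa using h.step hr
      · rcases ih (α ++ y) (by simp) with ⟨p', t, h₁, w, h₂⟩ | ⟨p', t, h₀, h₁, w, h₂⟩
        · exact .inl ⟨p', t, h₁, _, h₂.snoc hr trivial⟩
        · exact .inr ⟨p', t, h₀, h₁, _, h₂.snoc hr trivial⟩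
  · rintro (⟨p, t, h₁, w, h₂⟩ | ⟨p, β, -, h₁, w, h₂⟩)
    · exact h₁.reach.path (h₂.append_stack u)
    · exact h₁.path (h₂.append_stack u)

end RewriteSystem

/-! ### Finite index of the reachable pushdown words -/

/-- A family of languages is saturated by the classes of a map to a set of at most `n` elements,
where `u` and `u'` in the same class can replace each other as suffixes. -/
def FinIndex {ι Γ : Type} (n : ℕ) (T : ι → List Γ → Prop) : Prop :=
  ∃ (α : Type) (_ : Fintype α) (f : List Γ → α), Fintype.card α ≤ n ∧
    ∀ u u', f u = f u' → ∀ j v, T j (v ++ u) → T j (v ++ u')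

namespace RewriteSystem

variable {Q σ Γ : Type} {S : RewriteSystem Q σ Γ} {I : Q → List Γ → Prop}

/-- Lets a type with `(card Γ + 1) ^ m` elements stand for the words of length at most `m` in the
counting. -/
theorem exists_ofFn_reduceOption {m : ℕ} (β : List Γ) (h : β.length ≤ m) :
    ∃ w : Fin m → Option Γ, (List.ofFn w).reduceOption = β := by
  induction β generalizing m with
  | nil =>
    exact ⟨fun _ => none, by simp [List.reduceOption]⟩
  | cons Z β ih =>
    obtain ⟨m, rfl⟩ : ∃ m', m = m' + 1 := ⟨m - 1, by simp at h; omega⟩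
    obtain ⟨w, hw⟩ := ih (m := m) (by simpa using h)
    exact ⟨Fin.cons (some Z) w, by simp [List.ofFn_succ, hw]⟩

/-- By `reach_append_iff`, what can stand above `u` depends only on the start class of `u` and on
the set of pairs of a state and a word of length at most `m` that are reachable on top of `u`. -/
theorem finIndex_reach_of_start [Fintype Q] [Fintype Γ] {m n i : ℕ}
    (hm : ∀ q a α p β, S.rule q a α p β → β.length ≤ m) (h : FinIndex n (S.Start I i)) :
    FinIndex (n * 2 ^ (Fintype.card Q * (Fintype.card Γ + 1) ^ m)) (S.Reach I i) := by
  classical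
  obtain ⟨α, _, f, hc, hf⟩ := h
  refine ⟨α × Set (Q × (Fin m → Option Γ)), inferInstance,
    fun u => (f u, {x | S.Reach I i x.1 ((List.ofFn x.2).reduceOption ++ u)}), ?_, ?_⟩
  · rw [Fintype.card_prod]
    exact Nat.mul_le_mul hc (by simp)
  · intro u u' e q v hr
    rw [Prod.mk.injEq, Set.ext_iff] at e
    rw [reach_append_iff hm] at hr ⊢
    rcases hr with ⟨p, t, h₁, h₂⟩ | ⟨p, β, hβ, h₁, h₂⟩
    · exact .inl ⟨p, t, hf u u' e.1 p t h₁, h₂⟩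
    · obtain ⟨w, rfl⟩ := exists_ofFn_reduceOption β hβ
      exact .inr ⟨p, _, hβ, (e.2 (p, w)).1 h₁, h₂⟩

/-- A flip turns suffixes into prefixes. A prefix is classified by the pairs of a state and a suffix
class that complete it, whence the exponential; the two extra classes are for the empty suffix and
for suffixes that do not end in the bottom symbol. -/
theorem finIndex_start_succ [Fintype Q] {n i : ℕ} (h : FinIndex n (S.Reach I i)) :
    FinIndex (2 + 2 ^ (Fintype.card Q * n)) (S.Start I (i + 1)) := by
  classical
  obtain ⟨α, _, f, hc, hf⟩ := h
  let g : List Γ → Set (Q × α) := fun v => {x | ∃ u, f u = x.2 ∧ S.Reach I i x.1 (v ++ u)}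
  let F : List Γ → Option (Option (Set (Q × α))) := fun u =>
    if u = [] then none else if u.getLast? = some S.bottom then
      some (some (g u.dropLast.reverse)) else some none
  refine ⟨Option (Option (Set (Q × α))), inferInstance, F, ?_, ?_⟩
  · simp only [Fintype.card_option, Fintype.card_set, Fintype.card_prod]
    have := Nat.pow_le_pow_right (n := 2) (by omega) (Nat.mul_le_mul_left (Fintype.card Q) hc)
    omega
  · rintro u u' e q v ⟨p, t, hp, ht, hu⟩
    rcases List.eq_nil_or_concat' u with rfl | ⟨r, c, rfl⟩
    · have : u' = [] := by
        by_contra h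
        simp only [F, h, if_true, if_false] at e
        split_ifs at e
      subst this
      exact ⟨p, t, hp, ht, hu⟩
    · rw [← List.append_assoc] at hu
      obtain ⟨hvr, hb⟩ := List.append_inj' hu rfl
      obtain rfl : c = S.bottom := by simpa using hb
      rcases List.eq_nil_or_concat' u' with rfl | ⟨r', c', rfl⟩
      · simp [F] at e
      · by_cases hc' : c' = S.bottom
        · subst hc'
          simp only [F, List.append_eq_nil_iff, List.cons_ne_nil, and_false, if_false,
            List.getLast?_append, List.getLast?_singleton, Option.some_or, if_true,
            List.dropLast_concat, Option.some.injEq] at e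
          have ht' : t = r.reverse ++ v.reverse := by
            rw [← List.reverse_append, hvr, List.reverse_reverse]
          have : (p, f (v.reverse ++ [S.bottom])) ∈ g r'.reverse := by
            rw [← e]
            exact ⟨_, rfl, by simpa [ht'] using ht⟩
          obtain ⟨x, hx, hr⟩ := this
          refine ⟨p, r'.reverse ++ v.reverse, hp, ?_, by simp⟩
          simpa using hf _ _ hx p r'.reverse hr
        · simp [F, hc'] at e

/-- A bound on the number of classes of suffixes for the words reachable with at most `i` flips,
for `c` states and classes of initial words, where `A` accounts for the rules. -/
def indexBound (c A : ℕ) : ℕ → ℕ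
  | 0 => 3 * A
  | i + 1 => indexBound c A i * ((2 + 2 ^ (c * indexBound c A i)) * A)

theorem finIndex_reach [Fintype Q] [Fintype Γ] {m : ℕ}
    (hm : ∀ q a α p β, S.rule q a α p β → β.length ≤ m) (h : FinIndex 3 I) (k : ℕ) :
    FinIndex (indexBound (Fintype.card Q) (2 ^ (Fintype.card Q * (Fintype.card Γ + 1) ^ m)) k)
      (fun (x : ℕ × Q) s => x.1 ≤ k ∧ S.Reach I x.1 x.2 s) := by
  induction k with
  | zero =>
    obtain ⟨α, _, f, hc, hf⟩ := finIndex_reach_of_start (S := S) (I := I) (i := 0) hm h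
    refine ⟨α, _, f, hc, fun u u' e j v hj => ⟨hj.1, ?_⟩⟩
    obtain ⟨j, q⟩ := j
    obtain rfl : j = 0 := Nat.le_zero.1 hj.1
    exact hf u u' e q v hj.2
  | succ k ih =>
    obtain ⟨α, _, f, hc, hf⟩ := ih
    have h1 : FinIndex _ (S.Reach I k) :=
      ⟨α, _, f, hc, fun u u' e j v hj => (hf u u' e (k, j) v ⟨le_rfl, hj⟩).2⟩
    obtain ⟨β, _, g, hd, hg⟩ := finIndex_reach_of_start hm (finIndex_start_succ h1)
    refine ⟨α × β, inferInstance, fun u => (f u, g u), ?_, ?_⟩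
    · rw [Fintype.card_prod]
      exact Nat.mul_le_mul hc hd
    · rintro u u' e ⟨j, q⟩ v ⟨hj, hr⟩
      rw [Prod.mk.injEq] at e
      refine ⟨hj, ?_⟩
      rcases Nat.le_succ_iff.1 hj with hj | rfl
      · exact (hf u u' e.1 (j, q) v ⟨hj, hr⟩).2
      · exact hg u u' e.2 q v hr

/-! ### Phases have few left quotients -/

/-- The words read along `ok` paths within computations from `I` to `J` with at most `k` flips. -/
def phase (S : RewriteSystem Q σ Γ) (ok : List Γ → List Γ → Prop) (I J : Q → List Γ → Prop)
    (k : ℕ) : Set (List σ) :=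
  {x | ∃ i j q s p t, i + j ≤ k ∧ S.Reach I i q s ∧ S.Path ok q s x p t ∧ S.rev.Reach J j p t}

variable {ok : List Γ → List Γ → Prop} {J : Q → List Γ → Prop} {k : ℕ}

/-- Reduces nonincreasing phases to nondecreasing ones, so that only the latter need an index bound.
-/
theorem phase_rev (S : RewriteSystem Q σ Γ) (x : List σ) :
    x.reverse ∈ S.rev.phase (fun β α => ok α β) J I k ↔ x ∈ S.phase ok I J k := by
  constructor
  · rintro ⟨i, j, q, s, p, t, hk, h₁, h₂, h₃⟩
    exact ⟨j, i, p, t, q, s, by omega, h₃, List.reverse_reverse x ▸ h₂.rev, h₁⟩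
  · rintro ⟨i, j, q, s, p, t, hk, h₁, h₂, h₃⟩
    exact ⟨j, i, p, t, q, s, by omega, h₃, h₂.rev, h₁⟩

/-- The moves that read the letters around `x` are shifted into the computations before and after
the phase, whose input is not recorded. -/
theorem mem_phase_of_infix {x y : List σ} (h : y ∈ S.phase ok I J k) (hx : x <:+: y) :
    x ∈ S.phase ok I J k := by
  obtain ⟨u, v, rfl⟩ := hx
  obtain ⟨i, j, q, s, p, t, hk, h₁, h₂, h₃⟩ := h
  obtain ⟨m, r, h₄, h₅⟩ := h₂.split _ _ rfl
  obtain ⟨m', r', h₆, h₇⟩ := h₄.split _ _ rfl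
  exact ⟨i, j, m', r', m, r, hk, h₁.path h₆, h₇, h₃.path h₅.rev⟩

/-- A word is classified by the configurations in which the phase can be after reading it: state,
flips so far, top symbol (`none` for an empty pushdown) and class of the rest. By `exists_untouched`
the remaining phase never looks at the rest, so the rest can be exchanged for another of its class.
-/
theorem phase_index [Fintype Q] [Fintype Γ] {n : ℕ}
    (hS : ∀ q a α p β, S.rule q a α p β → ok α β → α.length ≤ β.length ∧ α.length ≤ 1)
    (h : FinIndex n (fun (x : ℕ × Q) s => x.1 ≤ k ∧ S.rev.Reach J x.1 x.2 s)) :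
    ∃ (α : Type) (_ : Fintype α) (f : List σ → α),
      Fintype.card α ≤ 2 ^ (Fintype.card Q * ((k + 1) * ((Fintype.card Γ + 1) * n))) ∧
      ∀ x y, f x = f y → ∀ v, x ++ v ∈ S.phase ok I J k → y ++ v ∈ S.phase ok I J k := by
  classical
  obtain ⟨α, _, f, hc, hf⟩ := h
  refine ⟨Set (Q × Fin (k + 1) × Option Γ × α), inferInstance,
    fun x => {d | ∃ y q s, S.Reach I d.2.1 q s ∧ S.Path ok q s x d.1 (d.2.2.1.toList ++ y) ∧
      f y = d.2.2.2}, ?_, ?_⟩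
  · simp only [Fintype.card_set, Fintype.card_prod, Fintype.card_fin, Fintype.card_option]
    gcongr
    omega
  · rintro x x' e v ⟨i, j, q, s, p, t, hk, h₁, h₂, h₃⟩
    obtain ⟨m, r, h₄, h₅⟩ := h₂.split _ _ rfl
    obtain ⟨Z, y, ζ, rfl, rfl, h₆⟩ := h₅.exists_untouched hS
    have := (Set.ext_iff.1 e (m, ⟨i, by omega⟩, Z, f y)).1 ⟨y, q, s, h₁, h₄, rfl⟩
    obtain ⟨y', q', s', h₇, h₈, h₉⟩ := this
    exact ⟨i, j, q', s', p, ζ ++ y', hk, h₇, h₈.trans (h₆.append_stack y'),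
      (hf y y' h₉.symm (j, p) ζ ⟨by simp only; omega, h₃⟩).2⟩

end RewriteSystem

/-- A language with at most `N` left quotients that contains all words of length at most `N`
contains all words. -/
theorem eq_univ_of_index {σ α : Type} [Fintype α] {N : ℕ} (P : Set (List σ)) (f : List σ → α)
    (hc : Fintype.card α ≤ N) (hf : ∀ x y, f x = f y → ∀ v, x ++ v ∈ P → y ++ v ∈ P)
    (hP : ∀ x : List σ, x.length ≤ N → x ∈ P) : P = Set.univ := by
  suffices ∀ l, ∀ x : List σ, x.length = l → x ∈ P from
    Set.eq_univ_of_forall fun x => this _ x rfl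
  intro l
  induction l using Nat.strong_induction_on with
  | _ l ih =>
    intro x hx
    by_cases hN : x.length ≤ N
    · exact hP x hN
    -- Two of the prefixes of lengths `0, …, N` share a class. Cutting out what lies between them
    -- gives a shorter word, which is in `P` by induction; then the shorter prefix is replaced by
    -- the longer one.
    obtain ⟨a, b, hab, e⟩ := Fintype.exists_ne_map_eq_of_card_lt
      (fun a : Fin (N + 1) => f (x.take a)) (by simp; omega)
    wlog hlt : a < b generalizing a b
    · exact this b a hab.symm e.symm (lt_of_le_of_ne (not_lt.1 hlt) hab.symm)
    have h := ih (x.take a ++ x.drop b).length (by simp; omega) _ rfl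
    have := hf _ _ e _ h
    rwa [List.take_append_drop] at this

end FlipPDA

/-! ### Density in terms of monotone phases -/

namespace FlipPDA

variable {Q σ Γ : Type}

/-- The moves of a machine as a prefix rewriting system. -/
def system (M : FlipPDA Q σ Γ) : RewriteSystem Q σ Γ :=
  ⟨fun q a α p β => ∃ Z, α = [Z] ∧ (q, a, Z, p, β) ∈ M.trans, fun q p => (q, p) ∈ M.flips, M.bottom⟩

/-- the initial configuration -/
def initial (M : FlipPDA Q σ Γ) (q : Q) (s : List Γ) : Prop := q = M.start ∧ s = [M.bottom]

/-- the configurations with a final state -/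
def accepting (M : FlipPDA Q σ Γ) (q : Q) (_ : List Γ) : Prop := q ∈ M.final

/-- The rules that do not decrease (`true`) or do not increase (`false`) the pushdown. -/
def Monotone (d : Bool) (α β : List Γ) : Prop :=
  if d then α.length ≤ β.length else β.length ≤ α.length

/-- The words read in monotone parts of accepting computations with at most `k` flips. -/
def monotonePhase (M : FlipPDA Q σ Γ) (k : ℕ) (d : Bool) : Set (List σ) :=
  M.system.phase (Monotone d) M.initial M.accepting k

variable {M : FlipPDA Q σ Γ} {q p : Q} {s t : List Γ} {w : List σ} {i j k : ℕ}

theorem Run.trans {c d e : Config Q σ Γ} {hs hs' : List ℕ} (h : M.Run c i hs d)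
    (h' : M.Run d j hs' e) : ∃ hs, M.Run c (i + j) hs e := by
  induction h with
  | refl => exact ⟨_, by simpa using h'⟩
  | move m _ ih => exact (ih h').imp' _ fun _ => .move m
  | flip m _ ih =>
    obtain ⟨_, h⟩ := ih h'
    exact ⟨_, by simpa [add_right_comm] using h.flip m⟩

theorem Run.of_path {ok : List Γ → List Γ → Prop} (h : M.system.Path ok q s w p t) (v : List σ) :
    ∃ hs, M.Run ⟨q, w ++ v, s⟩ 0 hs ⟨p, v, t⟩ := by
  induction h generalizing v with
  | refl => exact ⟨_, .refl _⟩
  | @snoc p p' α β t w a _ hr _ ih =>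
    obtain ⟨Z, rfl, hr⟩ := hr
    obtain ⟨hs, h⟩ := ih (a.toList ++ v)
    rw [List.append_assoc]
    exact h.trans (.move (.mk _ _ _ _ _ _ _ hr) (.refl _))

theorem Run.of_reach (h : M.system.Reach M.initial i q s) :
    ∃ w, ∀ v, ∃ hs, M.Run ⟨M.start, w ++ v, [M.bottom]⟩ i hs ⟨q, v, s⟩ := by
  induction h with
  | init h =>
    obtain ⟨rfl, rfl⟩ := h
    exact ⟨[], fun v => ⟨_, .refl _⟩⟩
  | @step i q p a α β t _ hr ih =>
    obtain ⟨Z, rfl, hr⟩ := hr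
    obtain ⟨w, h⟩ := ih
    refine ⟨w ++ a.toList, fun v => ?_⟩
    obtain ⟨hs, h⟩ := h (a.toList ++ v)
    rw [List.append_assoc]
    exact h.trans (.move (.mk _ _ _ _ _ _ _ hr) (.refl _))
  | flip _ hf ih =>
    obtain ⟨w, h⟩ := ih
    refine ⟨w, fun v => ?_⟩
    obtain ⟨hs, h⟩ := h v
    exact h.trans (.flip (.mk _ _ _ _ hf) (.refl _))

theorem Run.of_rev_reach (h : M.system.rev.Reach M.accepting i q s) :
    ∃ w, ∃ p ∈ M.final, ∃ t hs, M.Run ⟨q, w, s⟩ i hs ⟨p, [], t⟩ := by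
  induction h with
  | @init q s h => exact ⟨[], q, h, s, _, .refl _⟩
  | @step i q p a α β t _ hr ih =>
    obtain ⟨Z, rfl, hr⟩ := hr
    obtain ⟨w, p', hp, t', hs, h⟩ := ih
    exact ⟨a.toList ++ w, p', hp, t', _, .move (.mk _ _ _ _ _ _ _ hr) h⟩
  | @flip i q p t _ hf ih =>
    obtain ⟨w, p', hp, t', hs, h⟩ := ih
    have := Flip.mk (M := M) p q w t.reverse hf
    rw [List.reverse_reverse] at this
    exact ⟨w, p', hp, t', _, .flip this h⟩

theorem mem_infixes_of_mem_monotonePhase {d : Bool} {x : List σ} (h : x ∈ M.monotonePhase k d) :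
    x ∈ (M.language k).infixes := by
  obtain ⟨i, j, q, s, p, t, hk, h₁, h₂, h₃⟩ := h
  obtain ⟨u, h₁⟩ := Run.of_reach h₁
  obtain ⟨v, p', hp, t', hs, h₃⟩ := Run.of_rev_reach h₃
  obtain ⟨_, h₁⟩ := h₁ (x ++ v)
  obtain ⟨_, h₂⟩ := Run.of_path h₂ v
  obtain ⟨_, h⟩ := h₁.trans h₂
  obtain ⟨_, h⟩ := h.trans h₃
  exact ⟨_, ⟨_, hk, _, p', hp, t', h⟩, u, v, by simp⟩

theorem Run.head_sizes {c e : Config Q σ Γ} {hs : List ℕ} (h : M.Run c i hs e) :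
    ∃ hs', hs = c.stack.length :: hs' := by
  cases h <;> exact ⟨_, rfl⟩

theorem Run.reach {c e : Config Q σ Γ} {hs : List ℕ} (h : M.Run c i hs e)
    (he : e.state ∈ M.final) : M.system.rev.Reach M.accepting i c.state c.stack := by
  induction h with
  | refl => exact .init he
  | @move c d e i hs m _ ih =>
    cases m with
    | mk q p a w Z β s h => exact .step (S := M.system.rev) (ih he) ⟨Z, rfl, h⟩
  | flip m _ ih =>
    cases m with
    | mk q p w s h =>
      have := RewriteSystem.Reach.flip (S := M.system.rev) (ih he) (p := q) h
      rwa [List.reverse_reverse] at this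

/-- An accepting computation splits into monotone parts, boundedly many in terms of the numbers of
reversals and flips. The direction of the first one can be prescribed as long as it agrees with
that of the first change of size. -/
theorem Run.exists_phases {c e : Config Q σ Γ} {hs : List ℕ} (h : M.Run c i hs e)
    (he : e.state ∈ M.final) (he' : e.input = []) (i₀ : ℕ) (hk : i₀ + i ≤ k)
    (hc : M.system.Reach M.initial i₀ c.state c.stack) (d : Bool)
    (hd : ∀ d' ∈ (directions hs).head?, d' = d) :
    ∃ (w : List σ) (ws : List (List σ)) (p : Q) (t : List Γ) (j : ℕ),
      c.input = w ++ ws.flatten ∧ ws.length ≤ changes (directions hs) + i ∧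
      M.system.Path (Monotone d) c.state c.stack w p t ∧
      M.system.rev.Reach M.accepting j p t ∧ j ≤ i ∧
      ∀ x ∈ ws, ∃ d, x ∈ M.monotonePhase k d := by
  induction h generalizing i₀ d with
  | refl c =>
    exact ⟨[], [], c.state, c.stack, 0, he', by simp, .refl, .init he, le_rfl, by simp⟩
  | @flip c c' e i hs m hrun ih =>
    obtain ⟨hs', rfl⟩ := hrun.head_sizes
    have hcc := m
    cases m with
    | mk q p w s h =>
    -- A flip keeps the size and so does not show in `directions`. It ends the current piece; the
    -- additional piece is paid for by the flip count.
    have hdir : directions ((s ++ [M.bottom]).length :: (s.reverse ++ [M.bottom]).length :: hs') =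
        directions ((s.reverse ++ [M.bottom]).length :: hs') := by simp [directions]
    simp only at hd ⊢
    rw [hdir] at hd ⊢
    have hc' := RewriteSystem.Reach.flip (S := M.system) hc h
    obtain ⟨w', ws, p', t, j, h₁, h₂, h₃, h₄, h₅, h₆⟩ := ih he he' (i₀ + 1) (by omega) hc' d hd
    refine ⟨[], w' :: ws, q, _, i + 1, by simpa using h₁,
      by simp only [List.length_cons] at h₂ ⊢; omega, .refl,
      (hrun.flip hcc).reach he, le_rfl, ?_⟩
    rintro x (_ | ⟨_, hx⟩)
    · exact ⟨d, _, _, _, _, _, _, by omega, hc', h₃, h₄⟩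
    · exact h₆ x hx
  | @move c c' e i hs m hrun ih =>
    obtain ⟨hs', rfl⟩ := hrun.head_sizes
    cases m with
    | mk q p a w Z β s h =>
    have hr : M.system.rule q a [Z] p β := ⟨Z, rfl, h⟩
    have hc' := RewriteSystem.Reach.step (S := M.system) (α := [Z]) hc hr
    have hrev := hrun.reach he
    have key (d' : Bool) (hm : Monotone d' [Z] β) (hd' : ∀ d'' ∈
        (directions ((β ++ s).length :: hs')).head?, d'' = d') :
        ∃ (w' : List σ) (ws : List (List σ)) (p' : Q) (t : List Γ) (j : ℕ),
          a.toList ++ w = w' ++ ws.flatten ∧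
          ws.length ≤ changes (directions ((β ++ s).length :: hs')) + i ∧
          M.system.Path (Monotone d') q (Z :: s) w' p' t ∧
          M.system.rev.Reach M.accepting j p' t ∧ j ≤ i ∧
          ∀ x ∈ ws, ∃ d, x ∈ M.monotonePhase k d := by
      obtain ⟨w', ws, p', t, j, h₁, h₂, h₃, h₄⟩ := ih he he' i₀ hk hc' d' hd'
      refine ⟨a.toList ++ w', ws, p', t, j, ?_, h₂,
        (RewriteSystem.Path.single hr hm s).trans h₃, h₄⟩
      simp only at h₁
      rw [h₁, List.append_assoc]
    have strict (d' : Bool) (hm : Monotone d' [Z] β)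
        (hdir : directions ((Z :: s).length :: (β ++ s).length :: hs') =
          d' :: directions ((β ++ s).length :: hs')) :
        ∃ (w' : List σ) (ws : List (List σ)) (p' : Q) (t : List Γ) (j : ℕ),
          a.toList ++ w = w' ++ ws.flatten ∧
          ws.length ≤ changes (directions ((Z :: s).length :: (β ++ s).length :: hs')) + i ∧
          M.system.Path (Monotone d) q (Z :: s) w' p' t ∧
          M.system.rev.Reach M.accepting j p' t ∧ j ≤ i ∧
          ∀ x ∈ ws, ∃ d, x ∈ M.monotonePhase k d := by
      simp only at hd
      rw [hdir] at hd ⊢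
      obtain rfl : d' = d := hd d' (by simp)
      by_cases hh : ∀ d'' ∈ (directions ((β ++ s).length :: hs')).head?, d'' = d'
      · obtain ⟨w', ws, p', t, j, h₁, h₂, h₃⟩ := key d' hm hh
        refine ⟨w', ws, p', t, j, h₁, h₂.trans ?_, h₃⟩
        rcases directions ((β ++ s).length :: hs') with - | ⟨b, l⟩ <;> simp [changes]
      -- The direction changes after this move: the piece ends here, and the additional piece is
      -- paid for by the change.
      · push Not at hh
        obtain ⟨d'', hd'', hne⟩ := hh
        obtain ⟨w', ws, p', t, j, h₁, h₂, h₃, h₄, h₅, h₆⟩ := ih he he' i₀ hk hc' d''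
          (fun x hx => Option.mem_unique hx hd'')
        refine ⟨a.toList, w' :: ws, p, β ++ s, i, by simpa using h₁, ?_,
          RewriteSystem.Path.single hr hm s, hrev, le_rfl, ?_⟩
        · rcases hds : directions ((β ++ s).length :: hs') with - | ⟨b, l⟩
          · rw [hds] at hd''
            cases hd''
          · rw [hds] at hd''
            simp only [List.head?_cons, Option.mem_def, Option.some.injEq] at hd''
            simp only at h₂
            rw [hds] at h₂
            simp only [changes, hd'', if_neg hne.symm, List.length_cons]
            rw [hd''] at h₂
            omega
        · rintro x (_ | ⟨_, hx⟩)
          · exact ⟨d'', _, _, _, _, _, _, by omega, hc', h₃, h₄⟩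
          · exact h₆ x hx
    rcases lt_trichotomy (Z :: s).length (β ++ s).length with hlt | heq | hgt
    · exact strict true (by simp [Monotone] at hlt ⊢; omega) (by rw [directions, if_pos hlt])
    -- A move that keeps the size fits both directions, so the prescribed one is passed on.
    · have hdir : directions ((Z :: s).length :: (β ++ s).length :: hs') =
          directions ((β ++ s).length :: hs') := by simp [directions, heq]
      simp only at hd ⊢
      rw [hdir] at hd ⊢
      refine key d ?_ hd
      simp only [List.length_cons, List.length_append] at heq
      have : β.length = 1 := by omega
      cases d <;> simp [Monotone, this]
    · exact strict false (by
        simp only [List.length_cons, List.length_append] at hgt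
        simp only [Monotone, Bool.false_eq_true, if_false, List.length_cons, List.length_nil]
        omega)
        (by rw [directions, if_neg (by omega), if_pos hgt])

/-- The border between `u` and `v` cannot cut into both `x` and `y`. -/
theorem infix_or_infix_of_append {x y u v : List σ} (h : x ++ y <:+: u ++ v) :
    x <:+: u ∨ y <:+: v := by
  obtain ⟨a, b, h⟩ := h
  rw [List.append_assoc, List.append_assoc, ← List.append_assoc a] at h
  rcases List.append_eq_append_iff.1 h with ⟨z, hz, -⟩ | ⟨z, -, hz⟩
  · exact .inl ⟨a, z, hz.symm⟩
  · exact .inr ⟨z, b, by simpa using hz.symm⟩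

/-- There are at most `n - 1` borders between the pieces, and each spoils at most one of the `n`
copies. -/
theorem exists_infix_of_replicate {y w : List σ} {ws : List (List σ)} {n : ℕ}
    (hn : ws.length < n) (h : (List.replicate n y).flatten <:+: w ++ ws.flatten) :
    ∃ x ∈ w :: ws, y <:+: x := by
  induction ws generalizing w n with
  | nil =>
    obtain ⟨n, rfl⟩ : ∃ m, n = m + 1 := ⟨n - 1, by simp at hn; omega⟩
    refine ⟨w, by simp, .trans ⟨[], (List.replicate n y).flatten, ?_⟩ (by simpa using h)⟩
    simp [List.replicate_succ]
  | cons x ws ih =>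
    obtain ⟨n, rfl⟩ : ∃ m, n = m + 1 := ⟨n - 1, by simp at hn; omega⟩
    rw [List.replicate_succ, List.flatten_cons, List.flatten_cons] at h
    rcases infix_or_infix_of_append h with h | h
    · exact ⟨w, by simp, h⟩
    · obtain ⟨z, hz, h⟩ := ih (by simpa using hn) h
      exact ⟨z, by simp [List.mem_cons.1 hz], h⟩

theorem isDense_iff (hM : M.ReversalBounded k) :
    (M.language k).IsDense ↔ ∃ d, M.monotonePhase k d = Set.univ := by
  constructor
  · intro h
    by_contra! hne
    have hne' d := (Set.ne_univ_iff_exists_notMem _).1 (hne d)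
    obtain ⟨y₁, h₁⟩ := hne' true
    obtain ⟨y₂, h₂⟩ := hne' false
    obtain ⟨l, hl⟩ := hM
    -- There are at most `l + k` cuts, so one of the `l + k + 1` copies is undivided. It contains
    -- both `y₁` and `y₂`, so its piece can have neither direction.
    have hy : (List.replicate (l + k + 1) (y₁ ++ y₂)).flatten ∈ (M.language k).infixes := by
      rw [h]; trivial
    obtain ⟨w, ⟨i, hi, hs, hacc⟩, hinf⟩ := hy
    have hlen := hl w i hs hi hacc
    obtain ⟨q, hq, s, hrun⟩ := hacc
    have hd : ∃ d, ∀ d' ∈ (directions hs).head?, d' = d := by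
      cases (directions hs).head? <;> simp
    obtain ⟨d, hd⟩ := hd
    have hr : M.system.Reach M.initial 0 M.start [M.bottom] := .init ⟨rfl, rfl⟩
    obtain ⟨v, ws, p, t, j, e, hws, h₃, h₄, h₅, h₆⟩ :=
      hrun.exists_phases hq rfl 0 (k := k) (by omega) hr d hd
    simp only at e
    rw [e] at hinf
    obtain ⟨x, hx, hyx⟩ := exists_infix_of_replicate
      (show ws.length < l + k + 1 by rw [reversals] at hlen; omega) hinf
    have : ∃ d, x ∈ M.monotonePhase k d := by
      rcases List.mem_cons.1 hx with rfl | hx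
      · exact ⟨d, 0, j, _, _, _, _, by omega, hr, h₃, h₄⟩
      · exact h₆ x hx
    obtain ⟨d', hx⟩ := this
    cases d'
    · exact h₂ (RewriteSystem.mem_phase_of_infix hx (.trans ⟨y₁, [], by simp⟩ hyx))
    · exact h₁ (RewriteSystem.mem_phase_of_infix hx (.trans ⟨[], y₂, by simp⟩ hyx))
  · rintro ⟨d, hd⟩
    refine Set.eq_univ_of_forall fun x => mem_infixes_of_mem_monotonePhase (d := d) (k := k) ?_
    rw [hd]; trivial

end FlipPDA

/-! ### A computable length bound -/

namespace FlipPDA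

variable {Q σ Γ : Type} {M : FlipPDA Q σ Γ}

theorem finIndex_accepting : FinIndex 3 M.accepting :=
  ⟨Unit, inferInstance, fun _ => (), by simp, fun _ _ _ _ _ h => h⟩

/-- The two suffixes of `[M.bottom]` form a class each; all other words form the third. -/
theorem finIndex_initial : FinIndex 3 M.initial := by
  classical
  refine ⟨Fin 3, inferInstance, fun u => if u = [] then 0 else if u = [M.bottom] then 1 else 2,
    by simp, fun u u' e j v h => ?_⟩
  obtain ⟨h₁, h₂⟩ := h
  refine ⟨h₁, ?_⟩
  rcases u with - | ⟨Z, u⟩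
  · by_cases hu' : u' = []
    · rw [hu', h₂]
    · simp only [if_true, hu', if_false] at e
      split_ifs at e <;> simp at e
  · have hu : Z :: u = [M.bottom] := by
      rcases v with - | ⟨Y, v⟩
      · simpa using h₂
      · simp at h₂
    by_cases h0 : u' = []
    · simp [hu, h0] at e
    · by_cases h1 : u' = [M.bottom]
      · rw [h1, ← hu, h₂, hu]
      · simp [hu, h0, h1] at e

/-- A length such that a monotone phase contains all words if it contains those up to this length,
for `c` states, `g` pushdown symbols and at most `b` symbols pushed in a move. -/
def lengthBound (c g b k : ℕ) : ℕ :=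
  2 ^ (c * ((k + 1) * ((g + 1) * RewriteSystem.indexBound c (2 ^ (c * (g + 1) ^ b)) k)))

/-- A nondecreasing phase needs the classes of the words that lead to acceptance; rules read
backwards write one symbol, whence `1 ≤ b`. A nonincreasing phase is reversed and needs the classes
of the words reachable from the start. -/
theorem monotonePhase_eq_univ [Fintype Q] [Fintype Γ] {b k : ℕ} (hb : 1 ≤ b)
    (hM : ∀ q a Z p β, (q, a, Z, p, β) ∈ M.trans → β.length ≤ b) (d : Bool)
    (h : ∀ x : List σ, x.length ≤ lengthBound (Fintype.card Q) (Fintype.card Γ) b k →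
      x ∈ M.monotonePhase k d) :
    M.monotonePhase k d = Set.univ := by
  cases d
  · have hi := RewriteSystem.finIndex_reach (S := M.system) (m := b)
      (by rintro q a _ p β ⟨Z, rfl, h⟩; exact hM _ _ _ _ _ h) (finIndex_initial (M := M)) k
    obtain ⟨α, _, f, hc, hf⟩ := RewriteSystem.phase_index (S := M.system.rev)
      (ok := fun β α => Monotone false α β) (I := M.accepting)
      (by
        rintro q a α p _ ⟨Z, rfl, -⟩ hm
        simp only [Monotone, Bool.false_eq_true, if_false] at hm
        exact ⟨hm, by simpa using hm⟩) hi
    have := eq_univ_of_index _ f hc hf fun x hx => by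
      have := h x.reverse (by simpa [lengthBound] using hx)
      have := (RewriteSystem.phase_rev _ _).2 this
      rwa [List.reverse_reverse] at this
    refine Set.eq_univ_of_forall fun x => (RewriteSystem.phase_rev _ _).1 ?_
    rw [this]; trivial
  · have hi := RewriteSystem.finIndex_reach (S := M.system.rev) (m := b)
      (by rintro q a α p _ ⟨Z, rfl, h⟩; exact hb) (finIndex_accepting (M := M)) k
    obtain ⟨α, _, f, hc, hf⟩ := RewriteSystem.phase_index (S := M.system)
      (ok := Monotone true) (I := M.initial)
      (by
        rintro q a _ p β ⟨Z, rfl, -⟩ hm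
        exact ⟨hm, by simp⟩) hi
    exact eq_univ_of_index _ f hc hf h

end FlipPDA

-- Primitive recursiveness by `fun_prop`

attribute [fun_prop] Primrec

/-- Equality as a Boolean function. -/
def eqb {β : Type*} [DecidableEq β] (a b : β) : Bool := decide (a = b)

/-- The order of the natural numbers as a Boolean function. -/
def leb (a b : ℕ) : Bool := decide (a ≤ b)

@[simp] theorem eqb_eq_true {β : Type*} [DecidableEq β] {a b : β} : eqb a b = true ↔ a = b :=
  decide_eq_true_iff

@[simp] theorem leb_eq_true {a b : ℕ} : leb a b = true ↔ a ≤ b := decide_eq_true_iff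

namespace Primrec

variable {α β γ : Type*} [Primcodable α] [Primcodable β] [Primcodable γ]

@[fun_prop] theorem id_fun : Primrec fun a : α => a := Primrec.id

@[fun_prop] theorem const_fun (b : β) : Primrec fun _ : α => b := Primrec.const b

@[fun_prop] theorem comp_fun {f : β → γ} {g : α → β} (hf : Primrec f) (hg : Primrec g) :
    Primrec fun a => f (g a) := hf.comp hg

@[fun_prop] theorem pair_fun {f : α → β} {g : α → γ} (hf : Primrec f) (hg : Primrec g) :
    Primrec fun a => (f a, g a) := hf.pair hg

@[fun_prop] theorem fst_fun {f : α → β × γ} (hf : Primrec f) : Primrec fun a => (f a).1 :=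
  Primrec.fst.comp hf

@[fun_prop] theorem snd_fun {f : α → β × γ} (hf : Primrec f) : Primrec fun a => (f a).2 :=
  Primrec.snd.comp hf

@[fun_prop] theorem add_fun {f g : α → ℕ} (hf : Primrec f) (hg : Primrec g) :
    Primrec fun a => f a + g a := nat_add.comp hf hg

@[fun_prop] theorem mul_fun {f g : α → ℕ} (hf : Primrec f) (hg : Primrec g) :
    Primrec fun a => f a * g a := nat_mul.comp hf hg

@[fun_prop] theorem pow_fun {f g : α → ℕ} (hf : Primrec f) (hg : Primrec g) :
    Primrec fun a => f a ^ g a := (Primrec₂.unpaired'.1 Nat.Primrec.pow).comp hf hg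

@[fun_prop] theorem rec_fun {f : α → ℕ} {g : α → β} {h : α → ℕ → β → β} (hf : Primrec f)
    (hg : Primrec g) (hh : Primrec fun p : α × ℕ × β => h p.1 p.2.1 p.2.2) :
    Primrec fun a => (f a).rec (motive := fun _ => β) (g a) (h a) :=
  nat_rec' (h := fun a p => h a p.1 p.2) hf hg hh

@[fun_prop] theorem eqb_fun [DecidableEq β] {f g : α → β} (hf : Primrec f)
    (hg : Primrec g) : Primrec fun a => eqb (f a) (g a) := (Primrec.eq.comp hf hg).decide

@[fun_prop] theorem leb_fun {f g : α → ℕ} (hf : Primrec f)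
    (hg : Primrec g) : Primrec fun a => leb (f a) (g a) := (nat_le.comp hf hg).decide

@[fun_prop] theorem and_fun {f g : α → Bool} (hf : Primrec f) (hg : Primrec g) :
    Primrec fun a => f a && g a := Primrec.and.comp hf hg

@[fun_prop] theorem or_fun {f g : α → Bool} (hf : Primrec f) (hg : Primrec g) :
    Primrec fun a => f a || g a := Primrec.or.comp hf hg

@[fun_prop] theorem not_fun {f : α → Bool} (hf : Primrec f) :
    Primrec fun a => !f a := Primrec.not.comp hf

@[fun_prop] theorem cond_fun {f : α → Bool} {g h : α → β} (hf : Primrec f) (hg : Primrec g)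
    (hh : Primrec h) : Primrec fun a => bif f a then g a else h a := cond hf hg hh

@[fun_prop] theorem some_fun {f : α → β} (hf : Primrec f) : Primrec fun a => some (f a) :=
  option_some.comp hf

@[fun_prop] theorem optionToList_fun {f : α → Option β} (hf : Primrec f) :
    Primrec fun a => (f a).toList := optionToList.comp hf

@[fun_prop] theorem cons_fun {f : α → β} {g : α → List β} (hf : Primrec f) (hg : Primrec g) :
    Primrec fun a => f a :: g a := list_cons.comp hf hg

@[fun_prop] theorem append_fun {f g : α → List β} (hf : Primrec f) (hg : Primrec g) :
    Primrec fun a => f a ++ g a := list_append.comp hf hg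

@[fun_prop] theorem length_fun {f : α → List β} (hf : Primrec f) :
    Primrec fun a => (f a).length := list_length.comp hf

@[fun_prop] theorem head?_fun {f : α → List β} (hf : Primrec f) :
    Primrec fun a => (f a).head? := list_head?.comp hf

@[fun_prop] theorem tail_fun {f : α → List β} (hf : Primrec f) :
    Primrec fun a => (f a).tail := list_tail.comp hf

@[fun_prop] theorem reverse_fun {f : α → List β} (hf : Primrec f) :
    Primrec fun a => (f a).reverse := list_reverse.comp hf

@[fun_prop] theorem range_fun {f : α → ℕ} (hf : Primrec f) :
    Primrec fun a => List.range (f a) := list_range.comp hf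

@[fun_prop] theorem getElem?_fun {f : α → List β} {g : α → ℕ} (hf : Primrec f)
    (hg : Primrec g) : Primrec fun a => (f a)[g a]? := list_getElem?.comp hf hg

@[fun_prop] theorem getD_fun {f : α → List β} {g : α → ℕ} (d : β) (hf : Primrec f)
    (hg : Primrec g) : Primrec fun a => (f a).getD (g a) d := (list_getD d).comp hf hg

@[fun_prop] theorem foldr_fun {f : α → List β} {g : α → γ} {h : α → β → γ → γ} (hf : Primrec f)
    (hg : Primrec g) (hh : Primrec fun p : α × β × γ => h p.1 p.2.1 p.2.2) :
    Primrec fun a => (f a).foldr (h a) (g a) :=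
  list_foldr (h := fun a p => h a p.1 p.2) hf hg hh

@[fun_prop] theorem flatMap_fun {f : α → List β} {g : α → β → List γ} (hf : Primrec f)
    (hg : Primrec fun p : α × β => g p.1 p.2) : Primrec fun a => (f a).flatMap (g a) :=
  list_flatMap hf hg

@[fun_prop] theorem all_fun {p : α → β → Bool} {f : α → List β} (hf : Primrec f)
    (hp : Primrec fun q : α × β => p q.1 q.2) : Primrec fun a => (f a).all (p a) := by
  have h : PrimrecRel fun (b : β) (a : α) => p a b = true :=
    PrimrecRel.swap (r := fun a b => p a b = true) (Primrec.primrecPred (by simpa using hp))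
  refine (h.forall_mem_list.comp hf Primrec.id).decide.of_eq fun a => ?_
  rw [Bool.eq_iff_iff]
  simp

@[fun_prop] theorem any_fun {p : α → β → Bool} {f : α → List β} (hf : Primrec f)
    (hp : Primrec fun q : α × β => p q.1 q.2) : Primrec fun a => (f a).any (p a) := by
  refine (not_fun (all_fun (p := fun a b => !p a b) hf (not_fun hp))).of_eq fun a => ?_
  rw [Bool.eq_iff_iff]
  simp

end Primrec

/-! ### Search for the words of monotone phases -/

namespace FlipPDA

/-- The initial segment of the derivations of facts about a machine given by its description. A fact
`(l, i, q, x, s)` says that the configuration with state `q` and pushdown `s` can be reached with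
`i` flips, before (`l = 0`), during (`l = 1`) or after (`l = 2`) a monotone phase with direction `d`
in which `x` is read. This function gives the facts that follow from a fact in one step. -/
def successors (c : Code) (d : Bool) (f : ℕ × ℕ × ℕ × List ℕ × List ℕ) :
    List (ℕ × ℕ × ℕ × List ℕ × List ℕ) :=
  (bif leb f.1 1 then [(f.1 + 1, f.2)] else []) ++
  ((c.2.1.flatMap fun t =>
    bif eqb t.1 f.2.2.1 && eqb (f.2.2.2.2.head?) (some t.2.2.1) &&
      (!eqb f.1 1 ||
        bif d then leb 1 t.2.2.2.2.length else leb t.2.2.2.2.length 1)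
    then [(f.1, f.2.1, t.2.2.2.1,
      (bif eqb f.1 1 then f.2.2.2.1 ++ t.2.1.toList else f.2.2.2.1),
      t.2.2.2.2 ++ f.2.2.2.2.tail)] else []) ++
  (c.2.2.1.flatMap fun t =>
    bif !eqb f.1 1 && eqb t.1 f.2.2.1 &&
      eqb (f.2.2.2.2.reverse.head?) (some c.2.2.2.2.1)
    then [(f.1, f.2.1 + 1, t.2, f.2.2.2.1, f.2.2.2.2.reverse.tail ++ [c.2.2.2.2.1])] else []))

/-- the facts that can be derived in a given number of steps -/
def derivedFacts (c : Code) (d : Bool) (n : ℕ) : List (ℕ × ℕ × ℕ × List ℕ × List ℕ) :=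
  n.rec [(0, 0, c.2.2.2.1, [], [c.2.2.2.2.1])] fun _ l => l ++ l.flatMap (successors c d)

/-- the words that are found in a given number of steps to be in a monotone phase -/
def foundWords (c : Code) (k : ℕ) (d : Bool) (n : ℕ) : List (List ℕ) :=
  (derivedFacts c d n).flatMap fun f =>
    bif eqb f.1 2 && leb f.2.1 k && c.2.2.2.2.2.any (fun q => eqb q f.2.2.1)
    then [f.2.2.2.1] else []

/-- `lengthBound` in terms of the description of a machine -/
def codeBound (c : Code) (k : ℕ) : ℕ :=
  lengthBound c.1.1 c.1.2.2 ((c.2.1.flatMap fun t => t.2.2.2.2).length + 1) k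

/-- A list of words contains the empty word and with each of its words of length less than `N` the
extensions by the letters less than `n`. -/
def coversWords (n N : ℕ) (l : List (List ℕ)) : Bool :=
  l.any (fun x => eqb x []) && l.all fun x => leb N x.length ||
    (List.range n).all fun a => l.any fun y => eqb y (x ++ [a])

/-- In `n` steps all words up to the length bound are found to be in a monotone phase. -/
def denseCheck (c : Code) (k : ℕ) (d : Bool) (n : ℕ) : Bool :=
  coversWords c.1.2.1 (codeBound c k) (foundWords c k d n)

theorem primrec_successors :
    Primrec fun p : (Code × Bool) × ℕ × ℕ × ℕ × List ℕ × List ℕ =>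
      successors p.1.1 p.1.2 p.2 := by
  unfold successors
  fun_prop

theorem primrec_derivedFacts :
    Primrec fun p : (Code × Bool) × ℕ => derivedFacts p.1.1 p.1.2 p.2 := by
  have := primrec_successors
  unfold derivedFacts
  refine Primrec.rec_fun (by fun_prop) (by fun_prop) ?_
  refine Primrec.append_fun (by fun_prop) (Primrec.flatMap_fun (by fun_prop) ?_)
  exact this.comp (f := fun p : (Code × Bool) × ℕ × ℕ × ℕ × List ℕ × List ℕ =>
      successors p.1.1 p.1.2 p.2)
    (g := fun q : (((Code × Bool) × ℕ) × ℕ × List (ℕ × ℕ × ℕ × List ℕ × List ℕ)) ×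
      (ℕ × ℕ × ℕ × List ℕ × List ℕ) => (q.1.1.1, q.2)) (by fun_prop)

theorem primrec_foundWords :
    Primrec fun p : (Code × ℕ) × Bool × ℕ => foundWords p.1.1 p.1.2 p.2.1 p.2.2 := by
  unfold foundWords
  refine Primrec.flatMap_fun ?_ (by fun_prop)
  exact primrec_derivedFacts.comp
    (g := fun p : (Code × ℕ) × Bool × ℕ => ((p.1.1, p.2.1), p.2.2)) (by fun_prop)

theorem primrec_indexBound :
    Primrec fun p : (ℕ × ℕ) × ℕ => RewriteSystem.indexBound p.1.1 p.1.2 p.2 := by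
  have : Primrec fun p : (ℕ × ℕ) × ℕ => p.2.rec (motive := fun _ => ℕ) (3 * p.1.2)
      fun _ n => n * ((2 + 2 ^ (p.1.1 * n)) * p.1.2) := by fun_prop
  refine this.of_eq fun p => ?_
  obtain ⟨p, k⟩ := p
  induction k with
  | zero => rfl
  | succ k ih => simp only [RewriteSystem.indexBound, ← ih]

theorem primrec_codeBound : Primrec fun p : Code × ℕ => codeBound p.1 p.2 := by
  unfold codeBound lengthBound
  have := primrec_indexBound.comp (g := fun p : Code × ℕ => ((p.1.1.1,
    2 ^ (p.1.1.1 * (p.1.1.2.2 + 1) ^ ((p.1.2.1.flatMap fun t => t.2.2.2.2).length + 1))), p.2))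
    (by fun_prop)
  fun_prop

theorem primrec_coversWords :
    Primrec fun p : (ℕ × ℕ) × List (List ℕ) => coversWords p.1.1 p.1.2 p.2 := by
  unfold coversWords
  fun_prop

theorem primrec_denseCheck :
    Primrec fun p : (Code × ℕ) × Bool × ℕ => denseCheck p.1.1 p.1.2 p.2.1 p.2.2 := by
  have h := primrec_codeBound
  exact primrec_coversWords.comp
    (g := fun p : (Code × ℕ) × Bool × ℕ => ((p.1.1.1.2.1, codeBound p.1.1 p.1.2),
      foundWords p.1.1 p.1.2 p.2.1 p.2.2))
    (Primrec.pair_fun (Primrec.pair_fun (by fun_prop) (h.comp Primrec.fst)) primrec_foundWords)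

end FlipPDA

/-! ### Correctness of the search -/

namespace FlipPDA

variable {m n g : ℕ} {M : FlipPDA (Fin m) (Fin n) (Fin g)} {d : Bool} {k : ℕ}

/-- a fact about a machine in terms of its description -/
def fact (l i : ℕ) (q : Fin m) (x : List (Fin n)) (s : List (Fin g)) :
    ℕ × ℕ × ℕ × List ℕ × List ℕ :=
  (l, i, q.val, x.map Fin.val, s.map Fin.val)

theorem monotone_code {d : Bool} {Z : Fin g} {β : List (Fin g)} :
    ((bif d then leb 1 β.length else leb β.length 1) = true) ↔ Monotone d [Z] β := by
  cases d <;> simp [Monotone]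

theorem mem_successors {l i : ℕ} {q : Fin m} {x : List (Fin n)} {s : List (Fin g)}
    {F : ℕ × ℕ × ℕ × List ℕ × List ℕ} :
    F ∈ successors M.code d (fact l i q x s) ↔
      (l ≤ 1 ∧ F = fact (l + 1) i q x s) ∨
      (∃ a Z p β t, (q, a, Z, p, β) ∈ M.trans ∧ s = Z :: t ∧ (l = 1 → Monotone d [Z] β) ∧
        F = fact l i p (if l = 1 then x ++ a.toList else x) (β ++ t)) ∨
      (∃ p t, (q, p) ∈ M.flips ∧ l ≠ 1 ∧ s = t ++ [M.bottom] ∧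
        F = fact l (i + 1) p x (t.reverse ++ [M.bottom])) := by
  simp only [successors, List.mem_append]
  refine or_congr ?_ (or_congr ?_ ?_)
  · by_cases h : l ≤ 1 <;> simp [fact, h, leb]
  · simp only [code, List.mem_flatMap, List.mem_map]
    constructor
    · rintro ⟨_, ⟨⟨q', a, Z, p, β⟩, ht, rfl⟩, hF⟩
      rw [Bool.cond_eq_ite] at hF
      split_ifs at hF with hc
      · simp only [fact, Bool.and_eq_true, eqb_eq_true, Bool.or_eq_true, List.length_map,
          monotone_code (Z := Z), Bool.not_eq_true', ← Bool.not_eq_true] at hc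
        obtain ⟨⟨h₁, h₂⟩, h₃⟩ := hc
        rcases s with - | ⟨Y, t⟩
        · simp at h₂
        · simp only [List.map_cons, List.head?_cons, Option.some.injEq] at h₂
          obtain rfl := Fin.val_injective h₁
          obtain rfl := Fin.val_injective h₂
          refine ⟨a, Y, p, β, t, ht, rfl, fun hl => h₃.resolve_left (not_not.2 hl), ?_⟩
          rw [List.mem_singleton.1 hF]
          by_cases hl : l = 1 <;> cases a <;> simp [fact, hl, eqb]
      · simp at hF
    · rintro ⟨a, Z, p, β, t, ht, rfl, hm, rfl⟩
      refine ⟨_, ⟨_, ht, rfl⟩, ?_⟩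
      rw [Bool.cond_eq_ite, if_pos]
      · by_cases hl : l = 1 <;> cases a <;> simp [fact, hl, eqb]
      · simp only [fact, Bool.and_eq_true, eqb_eq_true, Bool.or_eq_true, List.length_map,
          monotone_code (Z := Z), Bool.not_eq_true', ← Bool.not_eq_true]
        exact ⟨⟨trivial, by simp⟩, (em (l = 1)).elim (fun h => .inr (hm h)) .inl⟩
  · simp only [code, List.mem_flatMap, List.mem_map]
    constructor
    · rintro ⟨_, ⟨⟨q', p⟩, ht, rfl⟩, hF⟩
      rw [Bool.cond_eq_ite] at hF
      split_ifs at hF with hc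
      · simp only [fact, Bool.and_eq_true, eqb_eq_true, Bool.not_eq_true',
          ← Bool.not_eq_true] at hc
        obtain ⟨⟨h₁, h₂⟩, h₃⟩ := hc
        rcases List.eq_nil_or_concat' s with rfl | ⟨t, Y, rfl⟩
        · simp at h₃
        · simp only [List.map_append, List.map_cons, List.map_nil, List.reverse_append,
            List.reverse_cons, List.reverse_nil, List.nil_append, List.cons_append,
            List.head?_cons, Option.some.injEq] at h₃
          obtain rfl := Fin.val_injective h₂
          obtain rfl := Fin.val_injective h₃
          refine ⟨p, t, ht, h₁, rfl, ?_⟩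
          rw [List.mem_singleton.1 hF]
          simp [fact]
      · simp at hF
    · rintro ⟨p, t, ht, hl, rfl, rfl⟩
      refine ⟨_, ⟨_, ht, rfl⟩, ?_⟩
      rw [Bool.cond_eq_ite, if_pos]
      · simp [fact]
      · simp [fact, eqb, hl]

/-- The facts that hold for a machine. -/
def Holds (M : FlipPDA (Fin m) (Fin n) (Fin g)) (d : Bool) :
    ℕ → ℕ → Fin m → List (Fin n) → List (Fin g) → Prop
  | 0, i, q, x, s => x = [] ∧ M.system.Reach M.initial i q s
  | 1, i, q, x, s => ∃ q₀ s₀, M.system.Reach M.initial i q₀ s₀ ∧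
      M.system.Path (Monotone d) q₀ s₀ x q s
  | _, i, q, x, s => ∃ i₀ i₁ q₀ s₀ p t, i = i₀ + i₁ ∧ M.system.Reach M.initial i₀ q₀ s₀ ∧
      M.system.Path (Monotone d) q₀ s₀ x p t ∧
      ∀ j, M.system.rev.Reach M.accepting j q s → M.system.rev.Reach M.accepting (j + i₁) p t

/-- After the phase, `Holds` takes the form of a continuation: acceptance from the present
configuration yields acceptance from the end of the phase. The reason is that `M.system.rev.Reach`
grows from the accepting end, whereas facts are derived forwards. -/
theorem holds_of_mem_derivedFacts {N : ℕ} {F : ℕ × ℕ × ℕ × List ℕ × List ℕ}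
    (hF : F ∈ derivedFacts M.code d N) : ∃ l i q x s, F = fact l i q x s ∧ Holds M d l i q x s := by
  induction N generalizing F with
  | zero =>
    refine ⟨0, 0, M.start, [], [M.bottom], ?_, rfl, .init ⟨rfl, rfl⟩⟩
    exact List.mem_singleton.1 hF
  | succ N ih =>
    rcases List.mem_append.1 hF with hF | hF
    · exact ih hF
    obtain ⟨F', hF', hF⟩ := List.mem_flatMap.1 hF
    obtain ⟨l, i, q, x, s, rfl, h⟩ := ih hF'
    rcases mem_successors.1 hF with ⟨hl, rfl⟩ | ⟨a, Z, p, β, t, ht, rfl, hm, rfl⟩ |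
      ⟨p, t, ht, hl, rfl, rfl⟩
    · refine ⟨_, _, _, _, _, rfl, ?_⟩
      match l, hl, h with
      | 0, _, h => exact ⟨q, s, h.2, h.1 ▸ .refl⟩
      | 1, _, h =>
        obtain ⟨q₀, s₀, h₁, h₂⟩ := h
        exact ⟨i, 0, q₀, s₀, q, s, rfl, h₁, h₂, fun _ h => h⟩
    · refine ⟨_, _, _, _, _, rfl, ?_⟩
      have hr : M.system.rule q a [Z] p β := ⟨Z, rfl, ht⟩
      match l, h with
      | 0, h => exact ⟨h.1, .step (α := [Z]) h.2 hr⟩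
      | 1, h =>
        obtain ⟨q₀, s₀, h₁, h₂⟩ := h
        exact ⟨q₀, s₀, h₁, .snoc (α := [Z]) h₂ hr (hm rfl)⟩
      | l + 2, h =>
        obtain ⟨i₀, i₁, q₀, s₀, p', t', h₀, h₁, h₂, h₃⟩ := h
        exact ⟨i₀, i₁, q₀, s₀, p', t', h₀, h₁, by simpa using h₂,
          fun j h => h₃ j (.step (S := M.system.rev) h hr)⟩
    · refine ⟨_, _, _, _, _, rfl, ?_⟩
      match l, hl, h with
      | 0, _, h => exact ⟨h.1, .flip h.2 ht⟩
      | l + 2, _, h =>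
        obtain ⟨i₀, i₁, q₀, s₀, p', t', h₀, h₁, h₂, h₃⟩ := h
        refine ⟨i₀, i₁ + 1, q₀, s₀, p', t', by omega, h₁, h₂, fun j h => ?_⟩
        have := h₃ (j + 1) (by
          have := RewriteSystem.Reach.flip (S := M.system.rev) h (p := q) ht
          rwa [List.reverse_reverse] at this)
        rwa [show j + (i₁ + 1) = j + 1 + i₁ by omega]

theorem derivedFacts_mono {c : Code} {N N' : ℕ} (h : N ≤ N') :
    derivedFacts c d N ⊆ derivedFacts c d N' := by
  induction h with
  | refl => exact List.Subset.refl _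
  | step _ ih => exact fun x hx => List.mem_append_left _ (ih hx)

theorem mem_derivedFacts_succ {N : ℕ} {F F' : ℕ × ℕ × ℕ × List ℕ × List ℕ} {c : Code}
    (hF : F ∈ derivedFacts c d N) (h : F' ∈ successors c d F) : F' ∈ derivedFacts c d (N + 1) :=
  List.mem_append_right _ (List.mem_flatMap.2 ⟨F, hF, h⟩)

theorem exists_derivedFacts_reach {i : ℕ} {q : Fin m} {s : List (Fin g)}
    (h : M.system.Reach M.initial i q s) : ∃ N, fact 0 i q ([] : List (Fin n)) s ∈
      derivedFacts M.code d N := by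
  induction h with
  | init h =>
    obtain ⟨rfl, rfl⟩ := h
    exact ⟨0, List.mem_singleton.2 rfl⟩
  | step _ hr ih =>
    obtain ⟨N, hN⟩ := ih
    obtain ⟨Z, rfl, hr⟩ := hr
    exact ⟨N + 1, mem_derivedFacts_succ hN (mem_successors.2
      (.inr (.inl ⟨_, _, _, _, _, hr, rfl, by simp, by simp⟩)))⟩
  | flip _ hf ih =>
    obtain ⟨N, hN⟩ := ih
    exact ⟨N + 1, mem_derivedFacts_succ hN (mem_successors.2
      (.inr (.inr ⟨_, _, hf, by simp, rfl, rfl⟩)))⟩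

theorem exists_derivedFacts_path {i : ℕ} {q p : Fin m} {s t : List (Fin g)} {x : List (Fin n)}
    (h : M.system.Path (Monotone d) q s x p t)
    (h' : ∃ N, fact 1 i q ([] : List (Fin n)) s ∈ derivedFacts M.code d N) :
    ∃ N, fact 1 i p x t ∈ derivedFacts M.code d N := by
  induction h with
  | refl => exact h'
  | snoc _ hr hm ih =>
    obtain ⟨N, hN⟩ := ih
    obtain ⟨Z, rfl, hr⟩ := hr
    exact ⟨N + 1, mem_derivedFacts_succ hN (mem_successors.2
      (.inr (.inl ⟨_, _, _, _, _, hr, rfl, fun _ => hm, by simp⟩)))⟩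

/-- Unwinding `h` moves forwards in the computation, so the derived fact travels in the hypothesis
`h'`, with `i` generalized to absorb the flips. -/
theorem exists_derivedFacts_rev_reach {i j : ℕ} {q : Fin m} {s : List (Fin g)} {x : List (Fin n)}
    (h : M.system.rev.Reach M.accepting j q s)
    (h' : ∃ N, fact 2 i q x s ∈ derivedFacts M.code d N) :
    ∃ (p : Fin m) (t : List (Fin g)) (N : ℕ),
      p ∈ M.final ∧ fact 2 (i + j) p x t ∈ derivedFacts M.code d N := by
  induction h generalizing i with
  | @init q s h => exact ⟨q, s, h'.choose, h, h'.choose_spec⟩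
  | step _ hr ih =>
    obtain ⟨N, hN⟩ := h'
    obtain ⟨Z, rfl, hr⟩ := hr
    exact ih ⟨N + 1, mem_derivedFacts_succ hN (mem_successors.2
      (.inr (.inl ⟨_, _, _, _, _, hr, rfl, by simp, by simp⟩)))⟩
  | @flip j q p t _ hf ih =>
    obtain ⟨N, hN⟩ := h'
    have := ih (i := i + 1) ⟨N + 1, mem_derivedFacts_succ hN (mem_successors.2
      (.inr (.inr ⟨_, _, hf, by simp, rfl, by rw [List.reverse_reverse]; rfl⟩)))⟩
    rwa [add_right_comm] at this

theorem mem_foundWords {N : ℕ} {y : List ℕ} : y ∈ foundWords M.code k d N ↔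
    ∃ (i : ℕ) (q : Fin m) (s : List (Fin g)), i ≤ k ∧ q ∈ M.final ∧
      ∃ x : List (Fin n), y = x.map Fin.val ∧ fact 2 i q x s ∈ derivedFacts M.code d N := by
  rw [foundWords, List.mem_flatMap]
  constructor
  · rintro ⟨F, hF, hy⟩
    obtain ⟨l, i, q, x, s, rfl, -⟩ := holds_of_mem_derivedFacts hF
    rw [Bool.cond_eq_ite] at hy
    split_ifs at hy with hc
    · simp only [fact, code, Bool.and_eq_true, eqb_eq_true, leb_eq_true, List.any_eq_true,
        List.mem_map, exists_exists_and_eq_and] at hc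
      obtain ⟨⟨rfl, hi⟩, q', hq', e⟩ := hc
      obtain rfl := Fin.val_injective e
      exact ⟨i, q', s, hi, hq', x, List.mem_singleton.1 hy, hF⟩
    · simp at hy
  · rintro ⟨i, q, s, hi, hq, x, rfl, hF⟩
    refine ⟨_, hF, ?_⟩
    rw [Bool.cond_eq_ite, if_pos]
    · exact List.mem_singleton.2 rfl
    · simp only [fact, code, Bool.and_eq_true, eqb_eq_true, leb_eq_true, List.any_eq_true,
        List.mem_map, exists_exists_and_eq_and]
      exact ⟨⟨trivial, hi⟩, q, hq, rfl⟩

theorem mem_monotonePhase_of_mem_foundWords {N : ℕ} {x : List (Fin n)}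
    (h : x.map Fin.val ∈ foundWords M.code k d N) : x ∈ M.monotonePhase k d := by
  obtain ⟨i, q, s, hi, hq, y, hy, hF⟩ := mem_foundWords.1 h
  obtain rfl := List.map_injective_iff.2 Fin.val_injective hy
  obtain ⟨l, i', q', x', s', e, h⟩ := holds_of_mem_derivedFacts hF
  simp only [fact, Prod.mk.injEq, Fin.val_inj,
    (List.map_injective_iff.2 Fin.val_injective).eq_iff] at e
  obtain ⟨rfl, rfl, rfl, rfl, rfl⟩ := e
  obtain ⟨i₀, i₁, q₀, s₀, p', t', rfl, h₁, h₂, h₃⟩ := h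
  exact ⟨i₀, i₁, q₀, s₀, p', t', hi, h₁, h₂, by simpa using h₃ 0 (.init hq)⟩

theorem exists_mem_foundWords {x : List (Fin n)} (h : x ∈ M.monotonePhase k d) :
    ∃ N, x.map Fin.val ∈ foundWords M.code k d N := by
  obtain ⟨i, j, q, s, p, t, hk, h₁, h₂, h₃⟩ := h
  obtain ⟨N, hN⟩ := exists_derivedFacts_reach (d := d) h₁
  obtain ⟨N, hN⟩ := exists_derivedFacts_path h₂ ⟨N + 1, mem_derivedFacts_succ hN
    (mem_successors.2 (.inl ⟨by simp, rfl⟩))⟩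
  obtain ⟨p', t', N, hp, hN⟩ := exists_derivedFacts_rev_reach h₃ ⟨N + 1, mem_derivedFacts_succ hN
    (mem_successors.2 (.inl ⟨by simp, rfl⟩))⟩
  exact ⟨N, mem_foundWords.2 ⟨_, p', t', hk, hp, x, rfl, hN⟩⟩

theorem foundWords_mono {c : Code} {N N' : ℕ} (h : N ≤ N') :
    foundWords c k d N ⊆ foundWords c k d N' := by
  intro x hx
  obtain ⟨F, hF, hx⟩ := List.mem_flatMap.1 hx
  exact List.mem_flatMap.2 ⟨F, derivedFacts_mono h hF, hx⟩

theorem coversWords_iff {N : ℕ} {l : List (List ℕ)} : coversWords n N l = true ↔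
    [] ∈ l ∧ ∀ x ∈ l, x.length < N → ∀ a < n, x ++ [a] ∈ l := by
  simp only [coversWords, Bool.and_eq_true, List.any_eq_true, eqb_eq_true, exists_eq_right,
    List.all_eq_true, Bool.or_eq_true, leb_eq_true, List.mem_range]
  refine and_congr_right fun _ => forall₂_congr fun x _ => ?_
  rw [or_iff_not_imp_left, not_le]

theorem codeBound_code : codeBound M.code k = lengthBound (Fintype.card (Fin m))
    (Fintype.card (Fin g)) ((M.trans.flatMap fun t => t.2.2.2.2).length + 1) k := by
  simp only [codeBound, code, Fintype.card_fin, List.length_flatMap, List.map_map]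
  congr 3
  simp [Function.comp_def]

theorem monotonePhase_eq_univ_of_denseCheck {N : ℕ} (h : denseCheck M.code k d N = true) :
    M.monotonePhase k d = Set.univ := by
  rw [denseCheck, coversWords_iff, codeBound_code] at h
  refine monotonePhase_eq_univ
    (b := (M.trans.flatMap fun t => t.2.2.2.2).length + 1) (Nat.le_add_left 1 _) ?_ d fun x hx =>
    mem_monotonePhase_of_mem_foundWords (N := N) ?_
  · intro q a Z p β hm
    refine Nat.le_succ_of_le ?_
    rw [List.length_flatMap]
    exact List.le_sum_of_mem (List.mem_map.2 ⟨_, hm, rfl⟩)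
  · induction x using List.reverseRecOn with
    | nil => exact h.1
    | append_singleton x a ih =>
      rw [List.length_append, List.length_singleton] at hx
      have := h.2 _ (ih (by omega)) (by simpa using hx) a.val a.isLt
      simpa using this

theorem exists_denseCheck (h : M.monotonePhase k d = Set.univ) :
    ∃ N, denseCheck M.code k d N = true := by
  -- Found words are never lost, so the finitely many short words are all found by a common step.
  have h₁ : ∀ x : List (Fin n), ∀ᶠ N in Filter.atTop, x.map Fin.val ∈ foundWords M.code k d N := by
    intro x
    obtain ⟨N, hN⟩ := exists_mem_foundWords (h ▸ Set.mem_univ x)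
    exact Filter.eventually_atTop.2 ⟨N, fun N' hN' => foundWords_mono hN' hN⟩
  have h₂ := (List.finite_length_le (Fin n) (codeBound M.code k)).eventually_all
    (l := Filter.atTop) (p := fun (x : List (Fin n)) N => x.map Fin.val ∈ foundWords M.code k d N)
  obtain ⟨N, hN⟩ := (h₂.2 fun x _ => h₁ x).exists
  refine ⟨N, ?_⟩
  rw [denseCheck, coversWords_iff]
  refine ⟨hN [] (Nat.zero_le _), fun y hy hlen a ha => ?_⟩
  obtain ⟨_, _, _, _, _, x, rfl, -⟩ := mem_foundWords.1 hy
  have := hN (x ++ [⟨a, ha⟩]) (by simpa using hlen)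
  rw [List.map_append] at this
  exact this

end FlipPDA

/-! ### Certificates of non-density -/

namespace FlipPDA

/-- Descriptions of certificates that a word is not an infix of an accepted word: the number of
classes of pushdown words, the class of the empty word, the effect on classes of adding a symbol at
the top, the effect of the reversal, an invariant set of tuples (state, number of flips, matched
part of the word, class) and the word. -/
abbrev Certificate : Type :=
  (ℕ × ℕ) × List (List ℕ) × List ℕ × List (ℕ × ℕ × ℕ × ℕ) × List ℕ

namespace Certificate

/-- the effect of a symbol at the top -/
def push (C : Certificate) (Z y : ℕ) : ℕ := (C.2.1.getD Z []).getD y 0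

/-- the effect of the reversal -/
def reverse (C : Certificate) (y : ℕ) : ℕ := C.2.2.1.getD y 0

/-- the effect of a symbol at the bottom -/
def pushBottom (C : Certificate) (y Z : ℕ) : ℕ := C.reverse (C.push Z (C.reverse y))

/-- The tables describe classes of words. -/
def checkClasses (C : Certificate) (g : ℕ) : Bool :=
  !leb C.1.1 C.1.2 && eqb (C.reverse C.1.2) C.1.2 &&
  ((List.range C.1.1).all fun y =>
    !leb C.1.1 (C.reverse y) && eqb (C.reverse (C.reverse y)) y) &&
  ((List.range g).all fun Z =>
    eqb (C.pushBottom C.1.2 Z) (C.push Z C.1.2) &&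
    (List.range C.1.1).all fun y => !leb C.1.1 (C.push Z y) &&
      (List.range g).all fun Y => eqb (C.pushBottom (C.push Y y) Z) (C.push Y (C.pushBottom y Z)))

/-- From having matched `j` letters of `x` one can pass to having matched `j'` letters when reading
`a`. All matching starts at `0` and stays at `x.length` once this is reached. -/
def next (x : List ℕ) (j : ℕ) (a : Option ℕ) (j' : ℕ) : Bool :=
  bif eqb a none then eqb j j' else
    (eqb j 0 && eqb j' 0) || (eqb x[j]? a && eqb j' (j + 1)) || (eqb j x.length && eqb j' j)

/-- The invariant is preserved by a transition. -/
def checkMove (C : Certificate) (t : ℕ × Option ℕ × ℕ × ℕ × List ℕ) (f : ℕ × ℕ × ℕ × ℕ) : Bool :=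
  !eqb f.1 t.1 || (List.range C.1.1).all fun y =>
    !eqb (C.push t.2.2.1 y) f.2.2.2 || (List.range (C.2.2.2.2.length + 1)).all fun j =>
      !next C.2.2.2.2 f.2.2.1 t.2.1 j ||
        C.2.2.2.1.any fun f' => eqb f' (t.2.2.2.1, f.2.1, j, t.2.2.2.2.foldr C.push y)

/-- The invariant is preserved by a flip. -/
def checkFlip (C : Certificate) (k b : ℕ) (t : ℕ × ℕ) (f : ℕ × ℕ × ℕ × ℕ) : Bool :=
  !eqb f.1 t.1 || leb k f.2.1 || (List.range C.1.1).all fun y =>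
    !eqb (C.pushBottom y b) f.2.2.2 ||
      C.2.2.2.1.any fun f' => eqb f' (t.2, f.2.1 + 1, f.2.2.1, C.pushBottom (C.reverse y) b)

end Certificate

/-- The certificate is valid for the machine with the given description with at most `k` flips. -/
def nondenseCheck (c : Code) (k : ℕ) (C : Certificate) : Bool :=
  C.checkClasses c.1.2.2 && (C.2.2.2.2.all fun a => !leb c.1.2.1 a) &&
  (C.2.2.2.1.any fun f => eqb f (c.2.2.2.1, 0, 0, C.push c.2.2.2.2.1 C.1.2)) &&
  C.2.2.2.1.all fun f =>
    (c.2.1.all fun t => C.checkMove t f) && (c.2.2.1.all fun t => C.checkFlip k c.2.2.2.2.1 t f) &&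
    !(eqb f.2.2.1 C.2.2.2.2.length && c.2.2.2.2.2.any fun q => eqb q f.1)

namespace Certificate

variable {α : Type*} [Primcodable α] {C : α → Certificate} {f g : α → ℕ}

@[fun_prop] theorem primrec_push (hC : Primrec C) (hf : Primrec f) (hg : Primrec g) :
    Primrec fun a => (C a).push (f a) (g a) := by
  unfold push
  fun_prop

@[fun_prop] theorem primrec_reverse (hC : Primrec C) (hf : Primrec f) :
    Primrec fun a => (C a).reverse (f a) := by
  unfold reverse
  fun_prop

@[fun_prop] theorem primrec_pushBottom (hC : Primrec C) (hf : Primrec f) (hg : Primrec g) :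
    Primrec fun a => (C a).pushBottom (f a) (g a) := by
  unfold pushBottom
  fun_prop

@[fun_prop] theorem primrec_checkClasses (hC : Primrec C) (hf : Primrec f) :
    Primrec fun a => (C a).checkClasses (f a) := by
  unfold checkClasses
  fun_prop

@[fun_prop] theorem primrec_next {x : α → List ℕ} {o : α → Option ℕ} (hx : Primrec x)
    (hf : Primrec f) (ho : Primrec o) (hg : Primrec g) :
    Primrec fun a => next (x a) (f a) (o a) (g a) := by
  unfold next
  fun_prop

@[fun_prop] theorem primrec_checkMove {t : α → ℕ × Option ℕ × ℕ × ℕ × List ℕ}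
    {e : α → ℕ × ℕ × ℕ × ℕ} (hC : Primrec C) (ht : Primrec t) (he : Primrec e) :
    Primrec fun a => (C a).checkMove (t a) (e a) := by
  unfold checkMove
  fun_prop

@[fun_prop] theorem primrec_checkFlip {t : α → ℕ × ℕ} {e : α → ℕ × ℕ × ℕ × ℕ} (hC : Primrec C)
    (hf : Primrec f) (hg : Primrec g) (ht : Primrec t) (he : Primrec e) :
    Primrec fun a => (C a).checkFlip (f a) (g a) (t a) (e a) := by
  unfold checkFlip
  fun_prop

end Certificate

theorem primrec_nondenseCheck :
    Primrec fun p : (Code × ℕ) × Certificate => nondenseCheck p.1.1 p.1.2 p.2 := by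
  unfold nondenseCheck
  fun_prop

end FlipPDA

/-! ### Soundness of certificates -/

namespace FlipPDA

namespace Certificate

variable {C : Certificate}

theorem not_leb {a b : ℕ} : (!leb a b) = true ↔ b < a := by
  rw [Bool.not_eq_true', ← Bool.not_eq_true, leb_eq_true, not_le]

theorem not_eqb {β : Type*} [DecidableEq β] {a b : β} : (!eqb a b) = true ↔ a ≠ b := by
  rw [Bool.not_eq_true', ← Bool.not_eq_true, eqb_eq_true]

theorem checkClasses_iff {g : ℕ} : C.checkClasses g = true ↔
    C.1.2 < C.1.1 ∧ C.reverse C.1.2 = C.1.2 ∧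
    (∀ y < C.1.1, C.reverse y < C.1.1 ∧ C.reverse (C.reverse y) = y) ∧
    ∀ Z < g, C.pushBottom C.1.2 Z = C.push Z C.1.2 ∧ ∀ y < C.1.1, C.push Z y < C.1.1 ∧
      ∀ Y < g, C.pushBottom (C.push Y y) Z = C.push Y (C.pushBottom y Z) := by
  simp only [checkClasses, Bool.and_eq_true, not_leb, eqb_eq_true, List.all_eq_true,
    List.mem_range, and_assoc]

theorem next_none {x : List ℕ} {j j' : ℕ} : next x j none j' = true ↔ j = j' := by
  simp [next, eqb]

theorem next_some {x : List ℕ} {j j' a : ℕ} : next x j (some a) j' = true ↔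
    (j = 0 ∧ j' = 0) ∨ (x[j]? = some a ∧ j' = j + 1) ∨ (j = x.length ∧ j' = j) := by
  simp [next, eqb, or_assoc]

theorem checkMove_iff {t : ℕ × Option ℕ × ℕ × ℕ × List ℕ} {f : ℕ × ℕ × ℕ × ℕ} :
    C.checkMove t f = true ↔ (f.1 = t.1 → ∀ y < C.1.1, C.push t.2.2.1 y = f.2.2.2 →
      ∀ j < C.2.2.2.2.length + 1, next C.2.2.2.2 f.2.2.1 t.2.1 j = true →
        (t.2.2.2.1, f.2.1, j, t.2.2.2.2.foldr C.push y) ∈ C.2.2.2.1) := by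
  simp only [checkMove, Bool.or_eq_true, not_eqb, List.all_eq_true, List.mem_range,
    List.any_eq_true, eqb_eq_true, exists_eq_right, ne_eq, ← imp_iff_not_or]
  simp only [Bool.not_eq_true', ← Bool.not_eq_true, ← imp_iff_not_or]

theorem checkFlip_iff {k b : ℕ} {t : ℕ × ℕ} {f : ℕ × ℕ × ℕ × ℕ} :
    C.checkFlip k b t f = true ↔ (f.1 = t.1 → f.2.1 < k → ∀ y < C.1.1,
      C.pushBottom y b = f.2.2.2 →
        (t.2, f.2.1 + 1, f.2.2.1, C.pushBottom (C.reverse y) b) ∈ C.2.2.2.1) := by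
  simp only [checkFlip, Bool.or_eq_true, not_eqb, List.all_eq_true, List.mem_range,
    List.any_eq_true, eqb_eq_true, exists_eq_right, ne_eq, leb_eq_true,
    ← imp_iff_not_or]
  simp only [or_iff_not_imp_left, Classical.not_imp, not_le, and_imp]

end Certificate

theorem nondenseCheck_iff {c : Code} {k : ℕ} {C : Certificate} :
    nondenseCheck c k C = true ↔ C.checkClasses c.1.2.2 = true ∧
      (∀ a ∈ C.2.2.2.2, a < c.1.2.1) ∧
      (c.2.2.2.1, 0, 0, C.push c.2.2.2.2.1 C.1.2) ∈ C.2.2.2.1 ∧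
      ∀ f ∈ C.2.2.2.1, (∀ t ∈ c.2.1, C.checkMove t f = true) ∧
        (∀ t ∈ c.2.2.1, C.checkFlip k c.2.2.2.2.1 t f = true) ∧
        (f.2.2.1 = C.2.2.2.2.length → f.1 ∉ c.2.2.2.2.2) := by
  simp only [nondenseCheck, Bool.and_eq_true, eqb_eq_true, List.all_eq_true,
    List.any_eq_true, exists_eq_right, leb_eq_true, Bool.not_eq_true', ← Bool.not_eq_true, not_and,
    not_le, and_assoc]

namespace Certificate

variable {m n g k : ℕ} {M : FlipPDA (Fin m) (Fin n) (Fin g)} {C : Certificate}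

/-- the class of a pushdown word -/
def cls (C : Certificate) (s : List (Fin g)) : ℕ := (s.map Fin.val).foldr C.push C.1.2

theorem cls_append (s t : List (Fin g)) :
    C.cls (s ++ t) = (s.map Fin.val).foldr C.push (C.cls t) := by
  simp [cls]

theorem cls_lt (h : C.checkClasses g = true) (s : List (Fin g)) : C.cls s < C.1.1 := by
  rw [checkClasses_iff] at h
  induction s with
  | nil => exact h.1
  | cons Z s ih => exact ((h.2.2.2 Z Z.isLt).2 _ ih).1

/-- The checked commutation with `push` carries the new symbol down to the empty word. Default
values from short tables are harmless, since the conditions are checked for the functions `push` and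
`reverse` themselves. -/
theorem pushBottom_cls (h : C.checkClasses g = true) (s : List (Fin g)) (Z : Fin g) :
    C.pushBottom (C.cls s) Z = C.cls (s ++ [Z]) := by
  have h' := checkClasses_iff.1 h
  induction s with
  | nil => exact (h'.2.2.2 Z Z.isLt).1
  | cons Y s ih =>
    exact (((h'.2.2.2 Z Z.isLt).2 _ (cls_lt h s)).2 Y Y.isLt).trans (congrArg (C.push Y) ih)

theorem reverse_cls (h : C.checkClasses g = true) (s : List (Fin g)) :
    C.reverse (C.cls s) = C.cls s.reverse := by
  have h' := checkClasses_iff.1 h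
  induction s with
  | nil => exact h'.2.1
  | cons Z s ih =>
    rw [List.reverse_cons, ← pushBottom_cls h, ← ih, pushBottom, (h'.2.2.1 _ (cls_lt h s)).2]
    rfl

end Certificate

variable {m n g k : ℕ} {M : FlipPDA (Fin m) (Fin n) (Fin g)} {C : Certificate}

/-- With `j` letters of `x` matched, a match of `x` can be completed within the input `w`. -/
def CanMatch (x : List (Fin n)) (j : ℕ) (w : List (Fin n)) : Prop :=
  (j = 0 ∧ x <:+: w) ∨ (j ≤ x.length ∧ x.drop j <+: w)

theorem CanMatch.le_length {x w : List (Fin n)} {j : ℕ} (h : CanMatch x j w) : j ≤ x.length := by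
  rcases h with h | h
  · exact h.1 ▸ Nat.zero_le _
  · exact h.1

/-- The matching waits at `0` until the occurrence of `x` begins, follows it, and then stays at
`x.length`. -/
theorem CanMatch.next {x w : List (Fin n)} {j : ℕ} {a : Option (Fin n)}
    (h : CanMatch x j (a.toList ++ w)) :
    ∃ j', Certificate.next (x.map Fin.val) j (a.map Fin.val) j' = true ∧ CanMatch x j' w := by
  cases a with
  | none => exact ⟨j, Certificate.next_none.2 rfl, h⟩
  | some a =>
    have key (hj : j ≤ x.length) (h : x.drop j <+: a :: w) :
        ∃ j', Certificate.next (x.map Fin.val) j (some a.val) j' = true ∧ CanMatch x j' w := by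
      rcases hj.eq_or_lt with rfl | hj
      · exact ⟨_, Certificate.next_some.2 (.inr (.inr ⟨by simp, rfl⟩)), .inr ⟨le_rfl, by simp⟩⟩
      · rw [List.drop_eq_getElem_cons hj, List.cons_prefix_cons] at h
        exact ⟨j + 1, Certificate.next_some.2 (.inr (.inl ⟨by simp [hj, h.1], rfl⟩)),
          .inr ⟨hj, h.2⟩⟩
    rcases h with ⟨rfl, h⟩ | ⟨hj, h⟩
    · rcases List.infix_cons_iff.1 h with h | h
      · exact key (Nat.zero_le _) (by simpa using h)
      · exact ⟨0, Certificate.next_some.2 (.inl ⟨rfl, rfl⟩), .inl ⟨rfl, h⟩⟩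
    · exact key hj h

/-- Following an occurrence of `x` in the input keeps the tuple of the current configuration in the
invariant set. When the input is used up the match is complete, and there the certificate excludes
final states. -/
theorem Run.notMem_final_of_check (hC : nondenseCheck M.code k C = true) {x : List (Fin n)}
    (hx : C.2.2.2.2 = x.map Fin.val) {c e : Config (Fin m) (Fin n) (Fin g)} {i i₀ j : ℕ}
    {hs : List ℕ} (h : M.Run c i hs e) (he : e.input = []) (hk : i₀ + i ≤ k)
    (hj : CanMatch x j c.input)
    (hc : (c.state.val, i₀, j, C.cls c.stack) ∈ C.2.2.2.1) : e.state ∉ M.final := by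
  obtain ⟨h₁, -, -, h₂⟩ := nondenseCheck_iff.1 hC
  change C.checkClasses g = true at h₁
  induction h generalizing i₀ j with
  | refl c =>
    rw [he] at hj
    have hj : j = x.length := by
      rcases hj with ⟨rfl, hj⟩ | ⟨hj', hj⟩
      · rw [List.infix_nil.1 hj, List.length_nil]
      · exact le_antisymm hj' (List.drop_eq_nil_iff.1 (List.prefix_nil.1 hj))
    have := (h₂ _ hc).2.2 (by simpa [hx] using hj)
    exact fun h => this (List.mem_map_of_mem h)
  | move hm _ ih =>
    cases hm with
    | mk q p a w Z β s ht =>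
      obtain ⟨j', hn, hj'⟩ := hj.next
      refine ih he hk hj' ?_
      have := Certificate.checkMove_iff.1 ((h₂ _ hc).1 _ (List.mem_map_of_mem ht)) rfl _
        (Certificate.cls_lt h₁ s) rfl j' (by
          rw [hx, List.length_map]
          exact Nat.lt_succ_of_le hj'.le_length) (by rw [hx]; exact hn)
      rw [Certificate.cls_append]
      exact this
  | @flip c d e i hs hf _ ih =>
    cases hf with
    | mk q p w s ht =>
      refine ih he (i₀ := i₀ + 1) (by omega) hj ?_
      have := Certificate.checkFlip_iff.1 ((h₂ _ hc).2.1 _ (List.mem_map_of_mem ht)) rfl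
        (show i₀ < k by omega) _ (Certificate.cls_lt h₁ s) (Certificate.pushBottom_cls h₁ s _)
      have e := Certificate.pushBottom_cls h₁ s.reverse M.bottom
      rw [← Certificate.reverse_cls h₁] at e
      rw [← e]
      exact this

theorem not_isDense_of_nondenseCheck (hC : nondenseCheck M.code k C = true) :
    ¬(M.language k).IsDense := by
  intro hd
  obtain ⟨-, hx, h₀, -⟩ := nondenseCheck_iff.1 hC
  replace hx : ∀ a ∈ C.2.2.2.2, a < n := hx
  obtain ⟨x, hx⟩ : ∃ x : List (Fin n), C.2.2.2.2 = x.map Fin.val := by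
    refine ⟨C.2.2.2.2.pmap (fun a h => (⟨a, h⟩ : Fin n)) hx, ?_⟩
    simp [List.map_pmap]
  obtain ⟨w, ⟨i, hi, hs, q, hq, s, hrun⟩, hw⟩ : x ∈ (M.language k).infixes := by
    rw [hd]; trivial
  exact hrun.notMem_final_of_check hC hx rfl (i₀ := 0) (by omega) (.inl ⟨rfl, hw⟩) h₀ hq

end FlipPDA

/-! ### Existence of certificates -/

namespace FlipPDA

/-- A family of finite index is saturated by finitely many classes of words that are compatible
with adding a symbol at the front and with reversal. -/
theorem FinIndex.exists_classes {ι Γ : Type} [Finite ι] {n : ℕ} {T : ι → List Γ → Prop}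
    (h : FinIndex n T) : ∃ (h : ℕ) (c : List Γ → Fin h), Function.Surjective c ∧
      ∀ s t, c s = c t → (∀ Z, c (Z :: s) = c (Z :: t)) ∧ c s.reverse = c t.reverse ∧
        ∀ j, T j s → T j t := by
  classical
  obtain ⟨α, _, f, -, hf⟩ := h
  -- While `f` classifies suffixes, `g` classifies prefixes by the suffix classes that complete
  -- them, and `h` classifies infixes by the classes of their surroundings.
  let g : List Γ → Set (ι × α) := fun v => {x | ∃ u, f u = x.2 ∧ T x.1 (v ++ u)}
  let h : List Γ → Set (ι × Set (ι × α) × α) := fun s =>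
    {x | ∃ u v, g v = x.2.1 ∧ f u = x.2.2 ∧ T x.1 (v ++ (s ++ u))}
  have key (s t : List Γ) (e : h s = h t) (u v : List Γ) (j : ι) (hs : T j (v ++ (s ++ u))) :
      T j (v ++ (t ++ u)) := by
    have : (j, g v, f u) ∈ h t := e ▸ ⟨u, v, rfl, rfl, hs⟩
    obtain ⟨u', v', hv, hu, ht⟩ := this
    replace hv : g v' = g v := hv
    rw [← List.append_assoc] at ht
    have ht := hf _ _ hu j _ ht
    rw [List.append_assoc] at ht
    have : (j, f (t ++ u)) ∈ g v := hv ▸ ⟨_, rfl, ht⟩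
    obtain ⟨u'', hu'', ht⟩ := this
    exact hf _ _ hu'' j _ ht
  -- The syntactic congruence of the family, imposed on a word and on its reversal so as to be
  -- compatible with reversal.
  let r : Setoid (List Γ) :=
    { r := fun s t => ∀ u v j, (T j (v ++ (s ++ u)) ↔ T j (v ++ (t ++ u))) ∧
        (T j (v ++ (s.reverse ++ u)) ↔ T j (v ++ (t.reverse ++ u)))
      iseqv := ⟨fun _ _ _ _ => ⟨Iff.rfl, Iff.rfl⟩,
        fun h u v j => ⟨(h u v j).1.symm, (h u v j).2.symm⟩,
        fun h h' u v j => ⟨(h u v j).1.trans (h' u v j).1, (h u v j).2.trans (h' u v j).2⟩⟩ }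
  have : Finite (Quotient r) := by
    refine Finite.of_injective (fun q => (h q.out, h q.out.reverse)) fun q q' e => ?_
    rw [Prod.mk.injEq] at e
    rw [← Quotient.out_equiv_out]
    exact fun u v j => ⟨⟨key _ _ e.1 u v j, key _ _ e.1.symm u v j⟩,
      ⟨key _ _ e.2 u v j, key _ _ e.2.symm u v j⟩⟩
  obtain ⟨N, ⟨e⟩⟩ := Finite.exists_equiv_fin (Quotient r)
  refine ⟨N, fun s => e (Quotient.mk r s), e.surjective.comp Quotient.mk_surjective,
    fun s t hst => ?_⟩
  have hst : ∀ u v j, (T j (v ++ (s ++ u)) ↔ T j (v ++ (t ++ u))) ∧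
      (T j (v ++ (s.reverse ++ u)) ↔ T j (v ++ (t.reverse ++ u))) :=
    Quotient.exact (e.injective hst)
  refine ⟨fun Z => congrArg e (Quotient.sound fun u v j => ⟨?_, ?_⟩),
    congrArg e (Quotient.sound fun u v j => ⟨(hst u v j).2, ?_⟩), fun j => ?_⟩
  · simpa using (hst u (v ++ [Z]) j).1
  · simpa using (hst (Z :: u) v j).2
  · simpa using (hst u v j).1
  · simpa using (hst [] [] j).1.1

variable {m n g k : ℕ} {M : FlipPDA (Fin m) (Fin n) (Fin g)}

/-- The machine together with the automaton that looks for the infix `x`. -/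
def matchSystem (M : FlipPDA (Fin m) (Fin n) (Fin g)) (x : List (Fin n)) :
    RewriteSystem (Fin m × Fin (x.length + 1)) (Fin n) (Fin g) :=
  ⟨fun q a α p β => M.system.rule q.1 a α p.1 β ∧
      Certificate.next (x.map Fin.val) q.2 (a.map Fin.val) p.2 = true,
    fun q p => M.system.flip q.1 p.1 ∧ q.2 = p.2, M.bottom⟩

/-- the initial configuration of `matchSystem` -/
def matchInitial (M : FlipPDA (Fin m) (Fin n) (Fin g)) (x : List (Fin n))
    (q : Fin m × Fin (x.length + 1)) (s : List (Fin g)) : Prop :=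
  M.initial q.1 s ∧ q.2 = 0

/-- A complete match in a final state will exhibit `x` as an infix of an accepted word. That `z` is
empty until then makes the matched letters contiguous. -/
theorem exists_run_of_match {x : List (Fin n)} {i : ℕ} {q : Fin m × Fin (x.length + 1)}
    {s : List (Fin g)} (h : (M.matchSystem x).Reach (M.matchInitial x) i q s) :
    ∃ w, (∀ v, ∃ hs, M.Run ⟨M.start, w ++ v, [M.bottom]⟩ i hs ⟨q.1, v, s⟩) ∧
      ∃ y z, w = y ++ x.take q.2 ++ z ∧ (q.2 < x.length → z = []) := by
  induction h with
  | init h =>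
    obtain ⟨⟨h₁, rfl⟩, h₂⟩ := h
    refine ⟨[], fun v => ?_, [], [], by simp [h₂], fun _ => rfl⟩
    rw [h₁]
    exact ⟨_, .refl _⟩
  | @step i q p a α β t _ hr ih =>
    obtain ⟨⟨Z, rfl, hr⟩, hn⟩ := hr
    obtain ⟨w, h, y, z, hw, hz⟩ := ih
    refine ⟨w ++ a.toList, fun v => ?_, ?_⟩
    · obtain ⟨hs, h⟩ := h (a.toList ++ v)
      rw [List.append_assoc]
      exact h.trans (.move (.mk _ _ _ _ _ _ _ hr) (.refl _))
    · cases a with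
      | none =>
        have := Certificate.next_none.1 hn
        exact ⟨y, z, by rw [← this]; simpa using hw, by rw [← this]; exact hz⟩
      | some a =>
        rcases Certificate.next_some.1 hn with ⟨-, h⟩ | ⟨hx, h⟩ | ⟨hx, h⟩
        · exact ⟨w ++ [a], [], by simp [h], fun _ => rfl⟩
        · have hlt : q.2.val < x.length := by
            by_contra hge
            rw [List.getElem?_eq_none (by simpa using hge)] at hx
            cases hx
          refine ⟨y, [], ?_, fun _ => rfl⟩
          have ha : x[q.2.val] = a := by simpa [hlt, Fin.val_inj] using hx
          rw [hw, hz hlt, h, List.take_succ_eq_append_getElem hlt, ha]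
          simp
        · rw [List.length_map] at hx
          exact ⟨y, z ++ [a], by rw [h, hw]; simp, fun hlt => by omega⟩
  | flip _ hf ih =>
    obtain ⟨w, h, y, z, hw, hz⟩ := ih
    obtain ⟨hf, he⟩ := hf
    rw [he] at hw hz
    refine ⟨w, fun v => ?_, y, z, hw, hz⟩
    obtain ⟨hs, h⟩ := h v
    exact h.trans (.flip (.mk _ _ _ _ hf) (.refl _))

theorem getD_ofFn {α : Type*} {h : ℕ} (f : Fin h → α) (d : α) (i : Fin h) :
    (List.ofFn f).getD i d = f i := by
  rw [List.getD_eq_getElem _ _ (by simp), List.getElem_ofFn]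

/-- The invariant consists of all tuples realized by reachable configurations of `matchSystem`, with
the classes from `FinIndex.exists_classes`. It need not be computed, as certificates are found by
search. -/
theorem exists_nondenseCheck (hd : ¬(M.language k).IsDense) :
    ∃ C, nondenseCheck M.code k C = true := by
  obtain ⟨x, hx⟩ := (Set.ne_univ_iff_exists_notMem _).1 hd
  let T : Fin (k + 1) × Fin m × Fin (x.length + 1) → List (Fin g) → Prop := fun a s =>
    (M.matchSystem x).Reach (M.matchInitial x) a.1 a.2 s
  have hI : FinIndex 3 (M.matchInitial x) := by
    obtain ⟨α, _, f, hc, hf⟩ := finIndex_initial (M := M)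
    exact ⟨α, _, f, hc, fun u u' e j v h => ⟨hf u u' e _ v h.1, h.2⟩⟩
  obtain ⟨h, c, hsurj, hc⟩ : ∃ (h : ℕ) (c : List (Fin g) → Fin h), Function.Surjective c ∧
      ∀ s t, c s = c t → (∀ Z, c (Z :: s) = c (Z :: t)) ∧ c s.reverse = c t.reverse ∧
        ∀ j, T j s → T j t := by
    obtain ⟨α, _, f, hc, hf⟩ := RewriteSystem.finIndex_reach (S := M.matchSystem x)
      (m := (M.trans.flatMap fun t => t.2.2.2.2).length) (by
        rintro q a _ p β ⟨⟨Z, rfl, hr⟩, -⟩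
        rw [List.length_flatMap]
        exact List.le_sum_of_mem (List.mem_map.2 ⟨_, hr, rfl⟩)) hI k
    exact FinIndex.exists_classes (n := Fintype.card α) ⟨α, _, f, le_rfl, fun u u' e j v ht =>
      (hf u u' e (j.1, j.2) v ⟨Nat.lt_succ_iff.1 j.1.isLt, ht⟩).2⟩
  let rep := Function.surjInv hsurj
  have hrep (y : Fin h) : c (rep y) = y := Function.surjInv_eq hsurj y
  let S : Set (ℕ × ℕ × ℕ × ℕ) :=
    {f | ∃ a s, f = (a.2.1.val, a.1.val, a.2.2.val, (c s).val) ∧ T a s}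
  obtain ⟨F, hF⟩ : ∃ F : List (ℕ × ℕ × ℕ × ℕ), ∀ f, f ∈ F ↔ f ∈ S := by
    have : S.Finite := (Set.finite_range fun a :
      (Fin (k + 1) × Fin m × Fin (x.length + 1)) × Fin h =>
      (a.1.2.1.val, a.1.1.val, a.1.2.2.val, a.2.val)).subset (by
        rintro _ ⟨a, s, rfl, -⟩
        exact ⟨(a, c s), rfl⟩)
    exact ⟨this.toFinset.toList, by simp⟩
  let C : Certificate := ((h, (c []).val),
    List.ofFn (fun Z => List.ofFn fun y => (c (Z :: rep y)).val),
    List.ofFn (fun y => (c (rep y).reverse).val), F, x.map Fin.val)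
  have hpush (Z : Fin g) (s : List (Fin g)) : C.push Z (c s) = c (Z :: s) := by
    simp only [Certificate.push, C, getD_ofFn]
    rw [(hc _ _ (hrep (c s))).1]
  have hrev (s : List (Fin g)) : C.reverse (c s) = c s.reverse := by
    simp only [Certificate.reverse, C, getD_ofFn]
    rw [(hc _ _ (hrep (c s))).2.1]
  have hbot (s : List (Fin g)) (Z : Fin g) : C.pushBottom (c s) Z = c (s ++ [Z]) := by
    rw [Certificate.pushBottom, hrev, hpush, hrev]
    simp
  have hfold (β s : List (Fin g)) :
      (β.map Fin.val).foldr C.push (c s) = c (β ++ s) := by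
    induction β with
    | nil => rfl
    | cons Z β ih => rw [List.map_cons, List.foldr_cons, ih, hpush, List.cons_append]
  -- Every class is that of some word, so the conditions on the tables become identities between
  -- words.
  have hall {p : ℕ → Prop} (hp : ∀ s, p (c s)) (y : ℕ) (hy : y < h) : p y := by
    obtain ⟨s, hs⟩ := hsurj ⟨y, hy⟩
    have := hp s
    rwa [hs] at this
  refine ⟨C, nondenseCheck_iff.2 ⟨Certificate.checkClasses_iff.2 ⟨(c []).isLt, hrev [], ?_, ?_⟩,
    ?_, ?_, ?_⟩⟩
  · refine hall fun s => ?_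
    rw [hrev, hrev, List.reverse_reverse]
    exact ⟨(c _).isLt, rfl⟩
  · intro Z hZ
    refine ⟨(hbot [] ⟨Z, hZ⟩).trans (hpush ⟨Z, hZ⟩ []).symm, hall fun s => ⟨?_, fun Y hY => ?_⟩⟩
    · rw [hpush ⟨Z, hZ⟩]
      exact (c _).isLt
    · rw [hpush ⟨Y, hY⟩, hbot _ ⟨Z, hZ⟩, hbot _ ⟨Z, hZ⟩, hpush ⟨Y, hY⟩]
      rfl
  · intro a ha
    obtain ⟨a, -, rfl⟩ := List.mem_map.1 ha
    exact a.isLt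
  · refine (hF _).2 ⟨(0, M.start, 0), [M.bottom], ?_, .init ⟨⟨rfl, rfl⟩, rfl⟩⟩
    rw [← hpush]
    rfl
  · intro f hf
    obtain ⟨⟨i, q, j⟩, s, rfl, hr⟩ := (hF f).1 hf
    refine ⟨fun t ht => Certificate.checkMove_iff.2 ?_, fun t ht => Certificate.checkFlip_iff.2 ?_,
      ?_⟩
    · obtain ⟨⟨q', a, Z, p, β⟩, hM, rfl⟩ := List.mem_map.1 ht
      intro e
      obtain rfl := Fin.val_injective e
      refine hall fun s' => fun e j' hj' hn => ?_
      rw [hpush, Fin.val_inj] at e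
      have hj' : j' < x.length + 1 := by simpa [C] using hj'
      refine (hF _).2 ⟨(i, p, ⟨j', hj'⟩), β ++ s', ?_, ?_⟩
      · rw [← hfold]
      -- The check concerns every `s'` for which `Z :: s'` has the class of `s`. As the classes
      -- saturate `T`, the word `Z :: s'` is itself reachable.
      · have hr' : T (i, _, j) (Z :: s') := (hc _ _ e.symm).2.2 _ hr
        exact .step (α := [Z]) hr' ⟨⟨Z, rfl, hM⟩, hn⟩
    · obtain ⟨⟨q', p⟩, hM, rfl⟩ := List.mem_map.1 ht
      intro e hi
      obtain rfl := Fin.val_injective e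
      refine hall fun s' => fun e => ?_
      have hb : M.code.2.2.2.2.1 = M.bottom.val := rfl
      rw [hb] at e ⊢
      rw [hbot, Fin.val_inj] at e
      refine (hF _).2 ⟨(⟨i + 1, Nat.succ_lt_succ hi⟩, p, j), s'.reverse ++ [M.bottom], ?_, ?_⟩
      · rw [hrev, hbot]
      · have hr' : T (i, _, j) (s' ++ [M.bottom]) := (hc _ _ e.symm).2.2 _ hr
        exact .flip (S := M.matchSystem x) hr' ⟨hM, rfl⟩
    · intro hj hq
      obtain ⟨q', hfin, e⟩ := List.mem_map.1 hq
      obtain rfl := Fin.val_injective e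
      obtain ⟨w, hw, y, z, rfl, -⟩ := exists_run_of_match hr
      have hj : j.val = x.length := by simpa [C] using hj
      obtain ⟨hs, hrun⟩ := hw []
      refine hx ⟨_, ⟨i, Nat.lt_succ_iff.1 i.isLt, hs, q', hfin, s, hrun⟩, y, z, ?_⟩
      simp [hj]

end FlipPDA

/-! ### The algorithm -/

/-- One algorithm decides density of `L(M)`, for all `k` and all reversal-bounded `k`-flip pushdown
automata `M`, from `k` and the description of `M` alone (no bound on the reversals is supplied). -/
theorem mainTheorem4 :
    ∃ f : FlipPDA.Code × ℕ →. Bool, Partrec f ∧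
      ∀ (m n g : ℕ) (M : FlipPDA (Fin m) (Fin n) (Fin g)) (k : ℕ), M.ReversalBounded k →
        ∃ b : Bool, f (M.code, k) = Part.some b ∧ (b = true ↔ (M.language k).IsDense) := by
  -- The number `N` is both a number of derivation steps and the code of a candidate certificate, so
  -- one unbounded search interleaves the two semidecision procedures.
  let F : FlipPDA.Code × ℕ → ℕ → Option Bool := fun p N =>
    bif FlipPDA.denseCheck p.1 p.2 true N || FlipPDA.denseCheck p.1 p.2 false N then some true
    else (Encodable.decode (α := FlipPDA.Certificate) N).bind fun C =>
      bif FlipPDA.nondenseCheck p.1 p.2 C then some false else none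
  have hF : Primrec₂ F := by
    have h₁ := FlipPDA.primrec_denseCheck
    have h₂ (d : Bool) : Primrec fun q : (FlipPDA.Code × ℕ) × ℕ =>
        FlipPDA.denseCheck q.1.1 q.1.2 d q.2 :=
      h₁.comp (g := fun q : (FlipPDA.Code × ℕ) × ℕ => (q.1, d, q.2)) (by fun_prop)
    have h₃ : Primrec fun q : ((FlipPDA.Code × ℕ) × ℕ) × FlipPDA.Certificate =>
        FlipPDA.nondenseCheck q.1.1.1 q.1.1.2 q.2 :=
      FlipPDA.primrec_nondenseCheck.comp
        (g := fun q : ((FlipPDA.Code × ℕ) × ℕ) × FlipPDA.Certificate => (q.1.1, q.2)) (by fun_prop)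
    refine Primrec.cond_fun (Primrec.or_fun (h₂ true) (h₂ false)) (Primrec.const _) ?_
    exact Primrec.option_bind (Primrec.decode.comp Primrec.snd)
      (Primrec.cond_fun h₃ (Primrec.const _) (Primrec.const _))
  have hF_iff p N b : b ∈ F p N → (b = true ∧ ∃ d, FlipPDA.denseCheck p.1 p.2 d N = true) ∨
      (b = false ∧ ∃ C, FlipPDA.nondenseCheck p.1 p.2 C = true) := by
    intro hb
    simp only [F, Bool.cond_eq_ite, Bool.or_eq_true] at hb
    split_ifs at hb with h
    · exact .inl ⟨by simpa using hb.symm, h.elim (fun h => ⟨_, h⟩) (fun h => ⟨_, h⟩)⟩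
    · obtain ⟨C, -, hb⟩ := Option.bind_eq_some_iff.1 hb
      split_ifs at hb with h
      exact .inr ⟨by simpa using hb.symm, C, h⟩
  refine ⟨fun p => Nat.rfindOpt (F p), Partrec.rfindOpt hF.to_comp, fun m n g M k hM => ?_⟩
  have hdense := FlipPDA.isDense_iff hM
  have hdom : (Nat.rfindOpt (F (M.code, k))).Dom := by
    rw [Nat.rfindOpt_dom]
    by_cases hd : (M.language k).IsDense
    · obtain ⟨d, hd⟩ := hdense.1 hd
      obtain ⟨N, hN⟩ := FlipPDA.exists_denseCheck hd
      refine ⟨N, true, ?_⟩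
      cases d <;> simp [F, hN]
    · obtain ⟨C, hC⟩ := FlipPDA.exists_nondenseCheck hd
      refine ⟨Encodable.encode C, ?_⟩
      simp only [F, Encodable.encodek, Option.bind_some, hC, cond_true]
      -- Only definedness matters here; whichever answer comes first is correct by soundness of both
      -- checks.
      cases FlipPDA.denseCheck M.code k true (Encodable.encode C) ||
        FlipPDA.denseCheck M.code k false (Encodable.encode C) <;> simp
  obtain ⟨b, hb⟩ := Part.dom_iff_mem.1 hdom
  refine ⟨b, Part.eq_some_iff.2 hb, ?_⟩
  obtain ⟨N, hN⟩ := Nat.rfindOpt_spec hb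
  rcases hF_iff _ _ _ hN with ⟨rfl, d, h⟩ | ⟨rfl, C, h⟩
  · exact iff_of_true rfl (hdense.2 ⟨d, FlipPDA.monotonePhase_eq_univ_of_denseCheck h⟩)
  · exact iff_of_false (by simp) (FlipPDA.not_isDense_of_nondenseCheck h)
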